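/- Let $(\mathscr W,\mathscr B(\mathscr W),\gamma)$ be the Wiener space on $[0,1]$: $\mathscr W$ is the space of continuous paths $w:[0,1]\to\mathbb R$ with $w(0)=0$, with the Borel $\sigma$-field of uniform convergence, and $\gamma$ is the Wiener measure, i.e. under $\gamma$ the process $w(t)$ is a centered Gaussian process with covariance $\min(s,t)$. Let $\mathscr H\subset\mathscr W$ be the Cameron–Martin space of absolutely continuous $h\in\mathscr W$ with $\dot h\in L^2(0,1)$, with $\langle h,k\rangle_{\mathscr H}=\int_0^1\dot h(t)\dot k(t)\,dt$ and norm $|\cdot|_{\mathscr H}$. For $h\in\mathscr H$ let $[h](w)=\int_0^1\dot h(t)\,dw(t)$, where the following version of the Wiener integral is used: $[h](w)$ is the limit as $n\to\infty$ of $\sum_{k<2^n}2^n\,(h(\tfrac{k+1}{2^n})-h(\tfrac{k}{2^n}))\,(w(\tfrac{k+1}{2^n})-w(\tfrac{k}{2^n}))$ for all $w$ in the linear subspace of $\mathscr W$ where this limit exists, and $[h]$ is extended from this subspace to a linear functional on $\mathscr W$. Let $\mathbf P$ be the set of polynomial functionals $F(w)=p([h_1](w),\dots,[h_n](w))$ with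 $n\in\mathbb N$, $h_1,\dots,h_n\in\mathscr H$ and $p$ a real polynomial in $n$ variables. For $\theta\in\mathscr H$ and functionals $F$ on $\mathscr W$ put $$D_\theta F(w)=\lim_{\varepsilon\to0}\frac{F(w+\varepsilon\theta)-F(w)}{\varepsilon},\qquad D_\theta^*F(w)=-D_\theta F(w)+[\theta](w)F(w),$$ $$e^{D_\theta}F(w)=\sum_{n=0}^\infty\frac1{n!}D_\theta^nF(w),\qquad e^{D_\theta^*}F(w)=\sum_{n=0}^\infty\frac1{n!}(D_\theta^*)^nF(w),$$ and let $H_n$ be the Hermite polynomials, $\exp(\lambda\xi-\lambda^2/2)=\sum_{n\ge0}\frac{\lambda^n}{n!}H_n[\xi]$. Theorem. For every $h\in\mathscr H$, $[h]$ is a version of the Wiener integral of $\dot h$: it is in $L^2(\gamma)$, and whenever step functions on $[0,1]$ converge to $\dot h$ in $L^2(0,1)$, their elementary integrals converge to $[h]$ in $L^2(\gamma)$. For every $\theta\in\mathscr H$ with $|\theta|_{\mathscr H}=1$: (1) for every $n=0,1,2,\dots$, $(D_\theta^*)^n1=H_n\big[\int_0^1\dot\theta(t)\,dw(t)\big]\in\mathbf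 P$, all the derivatives involved existing at every $w\in\mathscr W$; (2) for every $w\in\mathscr W$ the series $e^{D_\theta^*}1(w)$ converges, and $e^{D_\theta^*}1(w)=\exp\big\{\int_0^1\dot\theta(t)\,dw(t)-\tfrac12\big\}$; (3) for every $F\in\mathbf P$, all $D_\theta^nF$ exist at every $w\in\mathscr W$, $D_\theta^nF=0$ for all large $n$ (so the series $e^{D_\theta}F$ is a finite sum), $e^{D_\theta}F$ and $F\cdot e^{D_\theta^*}1$ are $\gamma$-integrable, and $$E\big[e^{D_\theta}F\big]=E\big[F\cdot e^{D_\theta^*}1\big].$$ -/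

import Mathlib

open MeasureTheory ProbabilityTheory Filter Topology

noncomputable section

namespace CameronMartin

/-- The path space `𝓦`: continuous real paths on `[0,1]` starting from zero, with the topology
(and norm) of uniform convergence. -/
abbrev PathSpace : Type :=
  ↥({ carrier := {w : C(unitInterval, ℝ) | w 0 = 0}
      add_mem' := fun {a b} ha hb => by
        simp only [Set.mem_ofPred_eq] at ha hb
        simp [ha, hb]
      zero_mem' := by simp
      smul_mem' := fun c a ha => by
        simp only [Set.mem_ofPred_eq] at ha
        simp [ha] } : Submodule ℝ C(unitInterval, ℝ))

/-- The Borel σ-field of the topology of uniform convergence. -/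
instance instMeasurableSpacePathSpace : MeasurableSpace PathSpace := borel PathSpace

instance instBorelSpacePathSpace : BorelSpace PathSpace := ⟨rfl⟩

/-- A path as a function of a real time variable (constant outside `[0,1]`). -/
def pathExt (w : PathSpace) : ℝ → ℝ :=
  Set.IccExtend (zero_le_one' ℝ) (fun t : unitInterval => w.1 t)

/-- `γ` is the Wiener measure: under `γ` the canonical process `W(t, w) = w t`, `0 ≤ t ≤ 1`, is a
centered Gaussian process with covariance `min s t`. This determines the Borel measure `γ`. -/
structure IsWienerMeasure (γ : Measure PathSpace) : Prop where
  isGaussianProcess : IsGaussianProcess (fun (t : unitInterval) (w : PathSpace) => w.1 t) γ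
  mean_eq_zero : ∀ t : unitInterval, ∫ w : PathSpace, w.1 t ∂γ = 0
  covariance_eq : ∀ s t : unitInterval,
    cov[fun w : PathSpace => w.1 s, fun w : PathSpace => w.1 t; γ] = min (s : ℝ) (t : ℝ)

/-- The derivative `ḣ` of a path (used for absolutely continuous paths, for which it exists almost
everywhere on `[0,1]`). -/
def pathDeriv (h : PathSpace) : ℝ → ℝ := deriv (pathExt h)

/-- The Cameron-Martin subspace `𝓗` of `𝓦`: absolutely continuous paths with square-integrable
derivative. -/
def cmSpace : Set PathSpace :=
  {h | AbsolutelyContinuousOnInterval (pathExt h) 0 1 ∧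
    MemLp (pathDeriv h) 2 (volume.restrict (Set.Icc (0 : ℝ) 1))}

/-- The inner product `⟨h, k⟩ = ∫₀¹ ḣ(t) k̇(t) dt` of `𝓗`. -/
def cmInner (h k : PathSpace) : ℝ := ∫ t in (0 : ℝ)..1, pathDeriv h t * pathDeriv k t

/-- The norm `|h|` of `𝓗`. -/
def cmNorm (h : PathSpace) : ℝ := Real.sqrt (cmInner h h)

/-! ### Wiener integrals -/

/-- Data of a step function on `(0,1]`: points `t 0 ≤ ⋯ ≤ t m` of `[0,1]`, values `a i`. -/
structure StepFunction where
  m : ℕ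
  t : Fin (m + 1) → unitInterval
  mono : Monotone t
  a : Fin m → ℝ

/-- The step function `∑ aᵢ 1_(tᵢ, tᵢ₊₁]`. -/
def StepFunction.toFun (s : StepFunction) (u : ℝ) : ℝ :=
  ∑ i : Fin s.m,
    Set.indicator (Set.Ioc (s.t i.castSucc : ℝ) (s.t i.succ : ℝ)) (fun _ => s.a i) u

/-- The elementary integral `∑ aᵢ (w(tᵢ₊₁) - w(tᵢ))`. -/
def StepFunction.elemIntegral (s : StepFunction) (w : PathSpace) : ℝ :=
  ∑ i : Fin s.m, s.a i * (w.1 (s.t i.succ) - w.1 (s.t i.castSucc))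

/-- `X` is (a version of) the Wiener integral `∫₀¹ f(t) dw(t)`: whenever step functions `sₖ` converge
to `f` in `L²(0,1)`, their elementary integrals converge to `X` in `L²(γ)`. -/
def IsWienerIntegral (γ : Measure PathSpace) (f : ℝ → ℝ) (X : PathSpace → ℝ) : Prop :=
  MemLp X 2 γ ∧
  ∀ s : ℕ → StepFunction,
    Tendsto (fun k => eLpNorm (fun u => (s k).toFun u - f u) 2
      (volume.restrict (Set.Icc (0 : ℝ) 1))) atTop (𝓝 0) →
    Tendsto (fun k => eLpNorm (fun w => (s k).elemIntegral w - X w) 2 γ) atTop (𝓝 0)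

/-- The elementary integral of the dyadic step function of level `n` whose value on
`(k 2⁻ⁿ, (k+1) 2⁻ⁿ]` is the average of `ḣ`, that is, `2ⁿ (h((k+1) 2⁻ⁿ) - h(k 2⁻ⁿ))`. -/
def dyadicIntegral (h : PathSpace) (n : ℕ) (w : PathSpace) : ℝ :=
  ∑ k ∈ Finset.range (2 ^ n),
    (2 : ℝ) ^ n * (pathExt h ((k + 1 : ℝ) / 2 ^ n) - pathExt h ((k : ℝ) / 2 ^ n)) *
      (pathExt w ((k + 1 : ℝ) / 2 ^ n) - pathExt w ((k : ℝ) / 2 ^ n))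

theorem ext_add (v w : PathSpace) (t : ℝ) : pathExt (v + w) t = pathExt v t + pathExt w t := rfl

theorem ext_smul (c : ℝ) (w : PathSpace) (t : ℝ) : pathExt (c • w) t = c * pathExt w t := rfl

theorem dyadicIntegral_add (h : PathSpace) (n : ℕ) (v w : PathSpace) :
    dyadicIntegral h n (v + w) = dyadicIntegral h n v + dyadicIntegral h n w := by
  simp only [dyadicIntegral, ext_add, ← Finset.sum_add_distrib]
  exact Finset.sum_congr rfl fun _ _ => by ring

theorem dyadicIntegral_smul (h : PathSpace) (n : ℕ) (c : ℝ) (w : PathSpace) :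
    dyadicIntegral h n (c • w) = c * dyadicIntegral h n w := by
  simp only [dyadicIntegral, ext_smul, Finset.mul_sum]
  exact Finset.sum_congr rfl fun _ _ => by ring

/-- The linear subspace of paths along which the dyadic integrals converge. -/
def convergenceSpace (h : PathSpace) : Submodule ℝ PathSpace where
  carrier := {w | ∃ l : ℝ, Tendsto (fun n => dyadicIntegral h n w) atTop (𝓝 l)}
  add_mem' := by
    rintro v w ⟨a, ha⟩ ⟨b, hb⟩
    exact ⟨a + b, by simpa only [dyadicIntegral_add] using ha.add hb⟩
  zero_mem' := ⟨0, by
    have : ∀ n, dyadicIntegral h n 0 = 0 := fun n => by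
      simpa using dyadicIntegral_smul h n 0 0
    simp [this]⟩
  smul_mem' := by
    rintro c w ⟨a, ha⟩
    exact ⟨c * a, by simpa only [dyadicIntegral_smul] using ha.const_mul c⟩

/-- The limit of the dyadic integrals, as a linear functional on `convergenceSpace h`. -/
def dyadicLimit (h : PathSpace) : convergenceSpace h →ₗ[ℝ] ℝ where
  toFun w := limUnder atTop (fun n => dyadicIntegral h n w.1)
  map_add' v w := by
    obtain ⟨a, ha⟩ := v.2
    obtain ⟨b, hb⟩ := w.2
    have hab : Tendsto (fun n => dyadicIntegral h n (v + w).1) atTop (𝓝 (a + b)) := by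
      simpa only [Submodule.coe_add, dyadicIntegral_add] using ha.add hb
    rw [hab.limUnder_eq, ha.limUnder_eq, hb.limUnder_eq]
  map_smul' c w := by
    obtain ⟨a, ha⟩ := w.2
    have hca : Tendsto (fun n => dyadicIntegral h n (c • w).1) atTop (𝓝 (c * a)) := by
      simpa only [Submodule.coe_smul, dyadicIntegral_smul] using ha.const_mul c
    rw [hca.limUnder_eq, ha.limUnder_eq]
    rfl

/-- The Wiener integral `[h](w) = ∫₀¹ ḣ(t) dw(t)`, as a function on path space: the limit of the
integrals of the dyadic step approximations of `ḣ` wherever it exists (almost surely, and on all of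
`𝓗`), extended to a linear functional on all of `𝓦`. The extension only matters on a null set;
linearity makes the directional derivatives of `[h]` exist at every path. -/
def wienerIntegral (h : PathSpace) : PathSpace →ₗ[ℝ] ℝ :=
  Classical.choose (LinearMap.exists_extend (dyadicLimit h))

/-! ### Polynomial functionals and the operators -/

/-- The set `𝐏` of polynomial functionals `w ↦ p([h₁](w), …, [hₙ](w))` with `hᵢ ∈ 𝓗`. -/
def polyFunctionals : Set (PathSpace → ℝ) :=
  {F | ∃ (n : ℕ) (h : Fin n → PathSpace) (p : MvPolynomial (Fin n) ℝ),
    (∀ i, h i ∈ cmSpace) ∧ ∀ w, F w = MvPolynomial.eval (fun i => wienerIntegral (h i) w) p}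

/-- `D_θ F(w) = lim_{ε → 0} (F(w + εθ) - F(w)) / ε`. -/
def D (θ : PathSpace) (F : PathSpace → ℝ) : PathSpace → ℝ := fun w => lineDeriv ℝ F w θ

/-- `D_θ^* F(w) = -D_θ F(w) + [θ](w) F(w)`. -/
def Dstar (θ : PathSpace) (F : PathSpace → ℝ) : PathSpace → ℝ :=
  fun w => -D θ F w + wienerIntegral θ w * F w

/-- `e^A F(w) = ∑ₙ (1 / n!) Aⁿ F(w)` for an operator `A` on functionals. -/
def expOp (A : (PathSpace → ℝ) → (PathSpace → ℝ)) (F : PathSpace → ℝ) : PathSpace → ℝ :=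
  fun w => ∑' n : ℕ, (1 / (n.factorial : ℝ)) * (A^[n] F) w

/-- The `n`-th (probabilists') Hermite polynomial `Hₙ[x]`. -/
def H (n : ℕ) (x : ℝ) : ℝ := Polynomial.aeval x (Polynomial.hermite n)

end CameronMartin

end

namespace CameronMartin

/-! The analytic part identifies `wienerIntegral h`. The covariance `min s t` makes the elementary
integrals of step functions an isometric Gaussian family (`StepFunction.integral_elemIntegral_mul`).
Dyadic averaging is an orthogonal projection in `L²(0,1)` with ranges growing in the level, so the
dyadic integrals of `ḣ` have increments uncorrelated with, hence by joint Gaussianity independent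
of, the past. They form an `L²`-bounded martingale and converge almost surely; the linear extension
chosen in `wienerIntegral` therefore matters only on a null set. Fatou's lemma carries the isometry
to the limit, and limits of Gaussian processes are Gaussian.

The algebraic part holds at every path, because `[h]` is linear everywhere and `[h](θ) = ⟨h, θ⟩`
exactly (`wienerIntegral_apply_of_mem`). A polynomial functional restricted to the line `w + tθ` is
a polynomial in `t`, on which `D_θ` is `d/dt`; Taylor's formula gives `e^{D_θ} F(w) = F(w + θ)`. On
functions of `[θ]` the operator `D_θ^*` is `x - d/dx`, which raises Hermite polynomials, and their
generating function at `λ = 1` sums `e^{D_θ^*} 1`.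

Duality is then the Cameron-Martin formula (`cameronMartin_poly`). Write `[hᵢ] = Zᵢ + cᵢ [θ]` with
`Z` independent of the standard Gaussian `[θ]`. Translation by `θ` fixes `Z` and adds `1` to `[θ]`,
so Fubini reduces the claim to completing a square on the line. -/

lemma measurable_eval (t : unitInterval) : Measurable fun w : PathSpace => w.1 t := by
  have : Continuous fun w : PathSpace => w.1 t :=
    (continuous_eval_const (F := C(unitInterval, ℝ)) t).comp continuous_subtype_val
  exact this.measurable

/-! ### Second moments of the coordinate process -/

namespace IsWienerMeasure

variable {γ : Measure PathSpace}

lemma isProbabilityMeasure (hγ : IsWienerMeasure γ) : IsProbabilityMeasure γ :=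
  hγ.isGaussianProcess.isProbabilityMeasure

lemma memLp_eval (hγ : IsWienerMeasure γ) (t : unitInterval) :
    MemLp (fun w : PathSpace => w.1 t) 2 γ :=
  (hγ.isGaussianProcess.hasGaussianLaw_eval t).memLp_two

lemma integral_eval_mul_eval (hγ : IsWienerMeasure γ) (s t : unitInterval) :
    ∫ w : PathSpace, w.1 s * w.1 t ∂γ = min (s : ℝ) t := by
  have := hγ.isProbabilityMeasure
  have h := hγ.covariance_eq s t
  rw [covariance_eq_sub (hγ.memLp_eval s) (hγ.memLp_eval t)] at h
  simpa [hγ.mean_eq_zero] using h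

/-- The four covariances `min` combine into the length of the overlap of the two time intervals, the
same number as the `L²` product of their indicators. -/
lemma integral_increment_mul_increment (hγ : IsWienerMeasure γ) (a b c d : unitInterval)
    (hab : a ≤ b) (hcd : c ≤ d) :
    ∫ w : PathSpace, (w.1 b - w.1 a) * (w.1 d - w.1 c) ∂γ =
      max 0 (min (b : ℝ) d - max (a : ℝ) c) := by
  have := hγ.isProbabilityMeasure
  have hi (s t : unitInterval) : Integrable (fun w : PathSpace => w.1 s * w.1 t) γ :=
    (hγ.memLp_eval s).integrable_mul (hγ.memLp_eval t)
  have hab' : (a : ℝ) ≤ b := hab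
  have hcd' : (c : ℝ) ≤ d := hcd
  have : ∀ w : PathSpace, (w.1 b - w.1 a) * (w.1 d - w.1 c) =
      (w.1 b * w.1 d - w.1 b * w.1 c) - (w.1 a * w.1 d - w.1 a * w.1 c) := fun w => by ring
  simp_rw [this]
  have hs (r s t : unitInterval) :
      Integrable (fun w : PathSpace => w.1 r * w.1 s - w.1 r * w.1 t) γ := (hi _ _).sub (hi _ _)
  rw [integral_sub (hs _ _ _) (hs _ _ _), integral_sub (hi _ _) (hi _ _),
    integral_sub (hi _ _) (hi _ _)]
  simp only [hγ.integral_eval_mul_eval]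
  grind

end IsWienerMeasure

/-! ### Step functions and the isometry -/

/-- Lebesgue measure on the unit interval. -/
noncomputable abbrev leb : Measure ℝ := volume.restrict (Set.Icc (0 : ℝ) 1)

lemma integral_indicator_mul_indicator (a b c d : unitInterval) (x y : ℝ) :
    ∫ u, (Set.Ioc (a : ℝ) b).indicator (fun _ => x) u * (Set.Ioc (c : ℝ) d).indicator (fun _ => y) u
      ∂leb = x * y * max 0 (min (b : ℝ) d - max (a : ℝ) c) := by
  have h : ∀ u, (Set.Ioc (a : ℝ) b).indicator (fun _ => x) u *
      (Set.Ioc (c : ℝ) d).indicator (fun _ => y) u =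
      (Set.Ioc (max (a : ℝ) c) (min (b : ℝ) d)).indicator (fun _ => x * y) u := by
    intro u
    rw [← Set.Ioc_inter_Ioc, Set.inter_indicator_mul]
  simp_rw [h]
  rw [integral_indicator measurableSet_Ioc, setIntegral_const, measureReal_def,
    Measure.restrict_apply measurableSet_Ioc, Set.inter_eq_left.2]
  · simp [mul_comm, ENNReal.toReal_ofReal', max_comm]
  · intro u hu
    have := a.2.1
    have := b.2.2
    simp only [Set.mem_Ioc, max_lt_iff, le_min_iff] at hu
    constructor <;> linarith

namespace StepFunction

lemma memLp_toFun (s : StepFunction) (p : ENNReal) : MemLp s.toFun p leb := by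
  unfold toFun
  refine memLp_finsetSum _ fun i _ => ?_
  exact (memLp_const (s.a i)).indicator measurableSet_Ioc

lemma measurable_elemIntegral (s : StepFunction) : Measurable s.elemIntegral := by
  unfold elemIntegral
  exact Finset.measurable_sum _ fun i _ =>
    ((measurable_eval _).sub (measurable_eval _)).const_mul _

/-- Each elementary integral is linear in finitely many coordinates. Indexing by all step functions
at once gives the joint Gaussianity on which the independence arguments rest. -/
lemma isGaussianProcess_elemIntegral {γ : Measure PathSpace} (hγ : IsWienerMeasure γ) :
    IsGaussianProcess elemIntegral γ := by
  classical
  refine hγ.isGaussianProcess.of_isGaussianProcess fun s => ?_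
  refine ⟨Finset.univ.image s.t,
    ∑ i : Fin s.m, s.a i • (ContinuousLinearMap.proj (R := ℝ) (⟨s.t i.succ, by simp⟩) -
      ContinuousLinearMap.proj (R := ℝ) (⟨s.t i.castSucc, by simp⟩)), fun w => ?_⟩
  simp [elemIntegral]

lemma memLp_elemIntegral {γ : Measure PathSpace} (hγ : IsWienerMeasure γ) (s : StepFunction) :
    MemLp s.elemIntegral 2 γ :=
  ((isGaussianProcess_elemIntegral hγ).hasGaussianLaw_eval s).memLp_two

lemma integral_elemIntegral {γ : Measure PathSpace} (hγ : IsWienerMeasure γ) (s : StepFunction) :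
    ∫ w, s.elemIntegral w ∂γ = 0 := by
  have := hγ.isProbabilityMeasure
  have hi (t : unitInterval) := (hγ.memLp_eval t).integrable one_le_two
  have hs (a : ℝ) (t r : unitInterval) :
      Integrable (fun w : PathSpace => a * (w.1 t - w.1 r)) γ := ((hi _).sub (hi _)).const_mul _
  unfold elemIntegral
  rw [integral_finsetSum _ fun i _ => hs _ _ _]
  refine Finset.sum_eq_zero fun i _ => ?_
  rw [integral_const_mul, integral_sub (hi _) (hi _)]
  simp [hγ.mean_eq_zero]

/-- The Itô isometry in polarized form: both sides are double sums of the same overlap lengths. -/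
lemma integral_elemIntegral_mul {γ : Measure PathSpace} (hγ : IsWienerMeasure γ)
    (s r : StepFunction) :
    ∫ w, s.elemIntegral w * r.elemIntegral w ∂γ = ∫ u, s.toFun u * r.toFun u ∂leb := by
  have := hγ.isProbabilityMeasure
  simp only [elemIntegral, toFun, Finset.sum_mul_sum]
  rw [integral_finsetSum, integral_finsetSum]
  · refine Finset.sum_congr rfl fun i _ => ?_
    rw [integral_finsetSum, integral_finsetSum]
    · refine Finset.sum_congr rfl fun j _ => ?_
      rw [integral_indicator_mul_indicator]
      simp_rw [mul_mul_mul_comm (s.a i)]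
      rw [integral_const_mul, hγ.integral_increment_mul_increment _ _ _ _
        (s.mono i.castSucc_le_succ) (r.mono j.castSucc_le_succ)]
    · intro j _
      exact MemLp.integrable_mul (p := 2) (q := 2) ((memLp_const _).indicator measurableSet_Ioc)
        ((memLp_const _).indicator measurableSet_Ioc)
    · intro j _
      exact (((hγ.memLp_eval _).sub (hγ.memLp_eval _)).const_mul _).integrable_mul
        (((hγ.memLp_eval _).sub (hγ.memLp_eval _)).const_mul _)
  · intro i _
    refine integrable_finsetSum _ fun j _ => ?_
    exact MemLp.integrable_mul (p := 2) (q := 2) ((memLp_const _).indicator measurableSet_Ioc)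
        ((memLp_const _).indicator measurableSet_Ioc)
  · intro i _
    refine integrable_finsetSum _ fun j _ => ?_
    exact (((hγ.memLp_eval _).sub (hγ.memLp_eval _)).const_mul _).integrable_mul
        (((hγ.memLp_eval _).sub (hγ.memLp_eval _)).const_mul _)

end StepFunction

/-- The `L²` seminorm in terms of the integral of the square. -/
lemma eLpNorm_two_eq_sqrt {α : Type*} {_ : MeasurableSpace α} {μ : Measure α} {f : α → ℝ}
    (hf : MemLp f 2 μ) : eLpNorm f 2 μ = ENNReal.ofReal (Real.sqrt (∫ x, f x ^ 2 ∂μ)) := by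
  rw [hf.eLpNorm_eq_integral_rpow_norm two_ne_zero ENNReal.ofNat_ne_top, Real.sqrt_eq_rpow]
  simp

lemma integral_sub_sq {α : Type*} {_ : MeasurableSpace α} {μ : Measure α} {f g : α → ℝ}
    (hf : MemLp f 2 μ) (hg : MemLp g 2 μ) :
    ∫ x, (f x - g x) ^ 2 ∂μ =
      ∫ x, f x * f x ∂μ - 2 * ∫ x, f x * g x ∂μ + ∫ x, g x * g x ∂μ := by
  have h : ∀ x, (f x - g x) ^ 2 = (f x * f x - 2 * (f x * g x)) + g x * g x := fun x => by ring
  simp_rw [h]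
  have h1 : Integrable (fun x => f x * f x) μ := hf.integrable_mul hf
  have h2 : Integrable (fun x => 2 * (f x * g x)) μ := (hf.integrable_mul hg).const_mul 2
  have h3 : Integrable (fun x => g x * g x) μ := hg.integrable_mul hg
  have h4 : Integrable (fun x => f x * f x - 2 * (f x * g x)) μ := h1.sub h2
  rw [integral_add h4 h3, integral_sub h1 h2, integral_const_mul]

/-- `StepFunction` carries no subtraction, so the isometry is applied to each of the three terms of
the expanded square. -/
lemma StepFunction.eLpNorm_elemIntegral_sub {γ : Measure PathSpace} (hγ : IsWienerMeasure γ)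
    (s r : StepFunction) :
    eLpNorm (fun w => s.elemIntegral w - r.elemIntegral w) 2 γ =
      eLpNorm (fun u => s.toFun u - r.toFun u) 2 leb := by
  rw [eLpNorm_two_eq_sqrt (f := fun w => s.elemIntegral w - r.elemIntegral w)
      ((memLp_elemIntegral hγ s).sub (memLp_elemIntegral hγ r)),
    eLpNorm_two_eq_sqrt (f := fun u => s.toFun u - r.toFun u)
      ((s.memLp_toFun 2).sub (r.memLp_toFun 2)),
    integral_sub_sq (memLp_elemIntegral hγ s) (memLp_elemIntegral hγ r),
    integral_sub_sq (s.memLp_toFun 2) (r.memLp_toFun 2)]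
  simp only [integral_elemIntegral_mul hγ]

/-! ### Dyadic averaging as an `L²` projection -/

/-- The coefficient `2ⁿ ∫ f` over the `k`-th dyadic interval of level `n`. -/
noncomputable def dyadicMean (f : ℝ → ℝ) (n k : ℕ) : ℝ :=
  2 ^ n * ∫ t in ((k : ℝ) / 2 ^ n)..((k + 1 : ℝ) / 2 ^ n), f t

/-- The dyadic step function of level `n` with the averages of `f` as its values. -/
noncomputable def dyadicAverage (f : ℝ → ℝ) (n : ℕ) : StepFunction where
  m := 2 ^ n
  t i := ⟨(i : ℕ) / 2 ^ n, by positivity, by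
    rw [div_le_one (by positivity)]
    exact_mod_cast Nat.lt_succ_iff.1 i.2⟩
  mono i j hij := by
    have : (i : ℕ) ≤ (j : ℕ) := hij
    show (i : ℕ) / (2 : ℝ) ^ n ≤ (j : ℕ) / 2 ^ n
    gcongr
  a i := dyadicMean f n i

lemma dyadic_mem_Icc {n k : ℕ} (hk : k ≤ 2 ^ n) : (k : ℝ) / 2 ^ n ∈ Set.Icc (0 : ℝ) 1 := by
  refine ⟨by positivity, ?_⟩
  rw [div_le_one (by positivity)]
  exact_mod_cast hk

lemma dyadic_succ_mem_Icc {n k : ℕ} (hk : k < 2 ^ n) :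
    (k + 1 : ℝ) / 2 ^ n ∈ Set.Icc (0 : ℝ) 1 := by
  exact_mod_cast dyadic_mem_Icc (Nat.succ_le_of_lt hk)

lemma dyadic_le_succ (n k : ℕ) : (k : ℝ) / 2 ^ n ≤ (k + 1 : ℝ) / 2 ^ n := by
  gcongr; linarith

lemma uIcc_dyadic_subset {n k : ℕ} (hk : k < 2 ^ n) :
    Set.uIcc ((k : ℝ) / 2 ^ n) ((k + 1 : ℝ) / 2 ^ n) ⊆ Set.Icc 0 1 := by
  rw [Set.uIcc_of_le (dyadic_le_succ n k)]
  exact Set.Icc_subset_Icc (dyadic_mem_Icc hk.le).1 (dyadic_succ_mem_Icc hk).2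

lemma dyadicAverage_toFun (f : ℝ → ℝ) (n : ℕ) (u : ℝ) :
    (dyadicAverage f n).toFun u = ∑ k ∈ Finset.range (2 ^ n),
      (Set.Ioc ((k : ℝ) / 2 ^ n) ((k + 1 : ℝ) / 2 ^ n)).indicator
        (fun _ => dyadicMean f n k) u := by
  rw [Finset.sum_range]
  simp [StepFunction.toFun, dyadicAverage]
  rfl

lemma dyadicAverage_apply (f : ℝ → ℝ) {n k : ℕ} (hk : k < 2 ^ n) {u : ℝ}
    (hu : u ∈ Set.Ioc ((k : ℝ) / 2 ^ n) ((k + 1 : ℝ) / 2 ^ n)) :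
    (dyadicAverage f n).toFun u = dyadicMean f n k := by
  rw [dyadicAverage_toFun, Finset.sum_eq_single_of_mem k (Finset.mem_range.2 hk)]
  · rw [Set.indicator_of_mem hu]
  · intro j _ hjk
    refine Set.indicator_of_notMem (fun hj => hjk ?_) _
    have h2 : (0 : ℝ) < 2 ^ n := by positivity
    simp only [Set.mem_Ioc, div_lt_iff₀ h2, le_div_iff₀ h2] at hu hj
    have h1 : (j : ℝ) < k + 1 := hj.1.trans_le hu.2
    have h3 : (k : ℝ) < j + 1 := hu.1.trans_le hj.2
    norm_cast at h1 h3
    omega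

lemma exists_mem_dyadic (n : ℕ) {u : ℝ} (hu : u ∈ Set.Ioc (0 : ℝ) 1) :
    ∃ k : ℕ, k < 2 ^ n ∧ u ∈ Set.Ioc ((k : ℝ) / 2 ^ n) ((k + 1 : ℝ) / 2 ^ n) := by
  have h2 : (0 : ℝ) < 2 ^ n := by positivity
  have hpos : 0 < ⌈u * 2 ^ n⌉₊ := Nat.ceil_pos.2 (mul_pos hu.1 h2)
  -- The intervals are open on the left, so the index is the ceiling minus one; `u > 0` keeps this
  -- subtraction from truncating.
  have hle : ⌈u * 2 ^ n⌉₊ ≤ 2 ^ n := by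
    rw [Nat.ceil_le]
    push_cast
    nlinarith [hu.2]
  refine ⟨⌈u * 2 ^ n⌉₊ - 1, by omega, ?_⟩
  simp only [Set.mem_Ioc, div_lt_iff₀ h2, le_div_iff₀ h2]
  constructor
  · exact Nat.lt_ceil.1 (by omega)
  · have := Nat.le_ceil (u * 2 ^ n)
    rwa [Nat.cast_sub hpos, Nat.cast_one, sub_add_cancel]

lemma integral_leb (f : ℝ → ℝ) : ∫ t, f t ∂leb = ∫ t in (0 : ℝ)..1, f t := by
  rw [intervalIntegral.integral_of_le zero_le_one, integral_Icc_eq_integral_Ioc]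

lemma intervalIntegrable_of_leb {f : ℝ → ℝ} (hf : Integrable f leb) {a b : ℝ}
    (h : Set.uIcc a b ⊆ Set.Icc 0 1) : IntervalIntegrable f volume a b :=
  intervalIntegrable_iff.2 (IntegrableOn.mono_set hf (Set.uIoc_subset_uIcc.trans h))

lemma integral_leb_eq_sum_dyadic {f : ℝ → ℝ} (hf : Integrable f leb) (n : ℕ) :
    ∫ t, f t ∂leb = ∑ k ∈ Finset.range (2 ^ n),
      ∫ t in ((k : ℝ) / 2 ^ n)..((k + 1 : ℝ) / 2 ^ n), f t := by
  have h := intervalIntegral.sum_integral_adjacent_intervals (μ := volume) (f := f)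
    (a := fun k : ℕ => (k : ℝ) / 2 ^ n) (n := 2 ^ n) (fun k hk => by
      push_cast
      exact intervalIntegrable_of_leb hf (uIcc_dyadic_subset hk))
  push_cast at h
  rw [h, integral_leb]
  simp

lemma integral_dyadicAverage_mul (f : ℝ → ℝ) {g : ℝ → ℝ} (hg : MemLp g 2 leb) (n : ℕ) :
    ∫ t, (dyadicAverage f n).toFun t * g t ∂leb = ∑ k ∈ Finset.range (2 ^ n),
      dyadicMean f n k * ∫ t in ((k : ℝ) / 2 ^ n)..((k + 1 : ℝ) / 2 ^ n), g t := by
  have hi : Integrable (fun t => (dyadicAverage f n).toFun t * g t) leb :=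
    ((dyadicAverage f n).memLp_toFun 2).integrable_mul hg
  rw [integral_leb_eq_sum_dyadic hi n]
  refine Finset.sum_congr rfl fun k hk => ?_
  rw [← intervalIntegral.integral_const_mul]
  refine intervalIntegral.integral_congr_ae (ae_of_all _ fun t ht => ?_)
  rw [Set.uIoc_of_le (dyadic_le_succ n k)] at ht
  simp only [dyadicAverage_apply f (Finset.mem_range.1 hk) ht]

lemma integral_dyadic_dyadicAverage (f : ℝ → ℝ) {n k : ℕ} (hk : k < 2 ^ n) :
    ∫ t in ((k : ℝ) / 2 ^ n)..((k + 1 : ℝ) / 2 ^ n), (dyadicAverage f n).toFun t =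
      ∫ t in ((k : ℝ) / 2 ^ n)..((k + 1 : ℝ) / 2 ^ n), f t := by
  have : ∫ t in ((k : ℝ) / 2 ^ n)..((k + 1 : ℝ) / 2 ^ n), (dyadicAverage f n).toFun t =
      ∫ t in ((k : ℝ) / 2 ^ n)..((k + 1 : ℝ) / 2 ^ n), dyadicMean f n k := by
    refine intervalIntegral.integral_congr_ae (ae_of_all _ fun t ht => ?_)
    rw [Set.uIoc_of_le (dyadic_le_succ n k)] at ht
    exact dyadicAverage_apply f hk ht
  rw [this, intervalIntegral.integral_const, dyadicMean, smul_eq_mul]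
  field_simp
  ring

/-- Orthogonality of the projection: the error `f - Aₙf` has zero integral over each dyadic
interval, where `Aₙf` is constant. -/
lemma integral_dyadicAverage_mul_self {f : ℝ → ℝ} (hf : MemLp f 2 leb) (n : ℕ) :
    ∫ t, (dyadicAverage f n).toFun t * (dyadicAverage f n).toFun t ∂leb =
      ∫ t, (dyadicAverage f n).toFun t * f t ∂leb := by
  rw [integral_dyadicAverage_mul f hf, integral_dyadicAverage_mul f (StepFunction.memLp_toFun _ 2)]
  refine Finset.sum_congr rfl fun k hk => ?_
  rw [integral_dyadic_dyadicAverage f (Finset.mem_range.1 hk)]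

/-- Pythagoras: `‖f‖² - ‖Aₙf‖² = ‖Aₙf - f‖² ≥ 0`. -/
lemma eLpNorm_dyadicAverage_le {f : ℝ → ℝ} (hf : MemLp f 2 leb) (n : ℕ) :
    eLpNorm (dyadicAverage f n).toFun 2 leb ≤ eLpNorm f 2 leb := by
  have hA := (dyadicAverage f n).memLp_toFun 2
  rw [eLpNorm_two_eq_sqrt hA, eLpNorm_two_eq_sqrt hf]
  refine ENNReal.ofReal_le_ofReal (Real.sqrt_le_sqrt ?_)
  have h1 := integral_sub_sq hA hf
  have h2 : 0 ≤ ∫ t, ((dyadicAverage f n).toFun t - f t) ^ 2 ∂leb :=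
    integral_nonneg fun t => sq_nonneg _
  rw [integral_dyadicAverage_mul_self hf] at h1
  simp only [pow_two] at h1 h2 ⊢
  rw [integral_dyadicAverage_mul_self hf]
  linarith

lemma dyadicMean_sub {f g : ℝ → ℝ} (hf : Integrable f leb) (hg : Integrable g leb) {n k : ℕ}
    (hk : k < 2 ^ n) : dyadicMean (f - g) n k = dyadicMean f n k - dyadicMean g n k := by
  simp only [dyadicMean, Pi.sub_apply]
  rw [intervalIntegral.integral_sub (intervalIntegrable_of_leb hf (uIcc_dyadic_subset hk))
    (intervalIntegrable_of_leb hg (uIcc_dyadic_subset hk)), mul_sub]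

lemma dyadicAverage_sub {f g : ℝ → ℝ} (hf : Integrable f leb) (hg : Integrable g leb) (n : ℕ) :
    (dyadicAverage (f - g) n).toFun = (dyadicAverage f n).toFun - (dyadicAverage g n).toFun := by
  ext u
  simp only [Pi.sub_apply, dyadicAverage_toFun, ← Finset.sum_sub_distrib]
  refine Finset.sum_congr rfl fun k hk => ?_
  rw [dyadicMean_sub hf hg (Finset.mem_range.1 hk)]
  simp only [Set.indicator_apply]
  split_ifs <;> simp

/-- The error at `u` is the mean of `g - g u` over a dyadic interval containing `u`, of length `2⁻ⁿ
< δ`. -/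
lemma abs_dyadicAverage_sub_le {g : ℝ → ℝ} (hg : Continuous g) {δ ε : ℝ} {n : ℕ}
    (hn : (1 / 2 : ℝ) ^ n < δ) (h : ∀ s t, |s - t| < δ → |g s - g t| ≤ ε) {u : ℝ}
    (hu : u ∈ Set.Ioc (0 : ℝ) 1) : |(dyadicAverage g n).toFun u - g u| ≤ ε := by
  obtain ⟨k, hk, huk⟩ := exists_mem_dyadic n hu
  rw [dyadicAverage_apply g hk huk]
  have h2 : (0 : ℝ) < 2 ^ n := by positivity
  have hlen : (k + 1 : ℝ) / 2 ^ n - k / 2 ^ n = (1 / 2) ^ n := by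
    rw [one_div_pow]; field_simp; ring
  have heq : dyadicMean g n k - g u =
      2 ^ n * ∫ t in ((k : ℝ) / 2 ^ n)..((k + 1 : ℝ) / 2 ^ n), (g t - g u) := by
    rw [intervalIntegral.integral_sub (hg.intervalIntegrable _ _) intervalIntegrable_const,
      intervalIntegral.integral_const, hlen, mul_sub, dyadicMean, smul_eq_mul, ← mul_assoc,
      ← mul_pow]
    norm_num
  have hb := intervalIntegral.norm_integral_le_of_norm_le_const (C := ε)
    (f := fun t => g t - g u) (a := (k : ℝ) / 2 ^ n) (b := (k + 1 : ℝ) / 2 ^ n) (fun t ht => by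
      rw [Set.uIoc_of_le (dyadic_le_succ n k)] at ht
      refine h _ _ (lt_of_le_of_lt ?_ hn)
      rw [← hlen, abs_le]
      constructor <;> linarith [ht.1, ht.2, huk.1, huk.2])
  rw [hlen, abs_of_pos (by positivity), Real.norm_eq_abs] at hb
  rw [heq, abs_mul, abs_of_pos h2]
  calc _ ≤ 2 ^ n * (ε * (1 / 2) ^ n) := by gcongr
    _ = ε := by rw [mul_left_comm, ← mul_pow]; norm_num

/-- Averaging over dyadic intervals converges to the identity in `L²(0,1)`. -/
lemma tendsto_dyadicAverage {f : ℝ → ℝ} (hf : MemLp f 2 leb) :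
    Tendsto (fun n => eLpNorm (fun u => (dyadicAverage f n).toFun u - f u) 2 leb) atTop (𝓝 0) := by
  rw [ENNReal.tendsto_atTop_zero]
  intro ε hε
  rcases eq_or_ne ε ⊤ with rfl | hεt
  · exact ⟨0, fun n _ => le_top⟩
  have hε3 : ε / 3 ≠ 0 := by simp [hε.ne']
  have hε3t : ε / 3 ≠ ⊤ := ENNReal.div_ne_top hεt (by norm_num)
  -- Three-epsilon argument with a continuous compactly supported `g`: the pieces are `Aₙ(f - g)`,
  -- controlled by contraction, `Aₙg - g`, controlled uniformly, and `f - g`.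
  obtain ⟨g, hgs, hfg, hg, hgm⟩ :=
    hf.exists_hasCompactSupport_eLpNorm_sub_le ENNReal.ofNat_ne_top hε3
  have hr : 0 < (ε / 3).toReal := ENNReal.toReal_pos hε3 hε3t
  obtain ⟨δ, hδ, hu⟩ := Metric.uniformContinuous_iff.1
    (hgs.uniformContinuous_of_continuous hg) _ hr
  obtain ⟨N, hN⟩ := exists_pow_lt_of_lt_one hδ (show (1 / 2 : ℝ) < 1 by norm_num)
  refine ⟨N, fun n hn => ?_⟩
  have hn' : (1 / 2 : ℝ) ^ n < δ :=
    (pow_le_pow_of_le_one (by norm_num) (by norm_num) hn).trans_lt hN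
  have hA := (dyadicAverage f n).memLp_toFun 2
  have hB := (dyadicAverage g n).memLp_toFun 2
  have hC := (dyadicAverage (f - g) n).memLp_toFun 2
  have h1 : (fun u => (dyadicAverage f n).toFun u - f u) =
      (dyadicAverage (f - g) n).toFun + ((dyadicAverage g n).toFun - g) - (f - g) := by
    rw [dyadicAverage_sub (hf.integrable one_le_two) (hgm.integrable one_le_two)]
    ext u
    simp
  have h2 : eLpNorm ((dyadicAverage g n).toFun - g) 2 leb ≤ ε / 3 := by
    have hb : ∀ᵐ u ∂leb, ‖((dyadicAverage g n).toFun - g) u‖ ≤ (ε / 3).toReal := by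
      -- The point `0` lies in no half-open dyadic interval and is discarded as a null set.
      have : leb = volume.restrict (Set.Ioc (0 : ℝ) 1) := Measure.restrict_congr_set
        Ioc_ae_eq_Icc.symm
      rw [this, ae_restrict_iff' measurableSet_Ioc]
      exact ae_of_all _ fun u hu' => abs_dyadicAverage_sub_le hg hn'
        (fun s t hst => (hu (by simpa [Real.dist_eq] using hst)).le) hu'
    refine (eLpNorm_le_of_ae_bound hb).trans ?_
    rw [ENNReal.ofReal_toReal hε3t]
    simp
  rw [h1]
  calc _ ≤ eLpNorm ((dyadicAverage (f - g) n).toFun + ((dyadicAverage g n).toFun - g)) 2 leb +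
        eLpNorm (f - g) 2 leb := eLpNorm_sub_le (hC.add (hB.sub hgm)).1 (hf.sub hgm).1 one_le_two
    _ ≤ (eLpNorm (dyadicAverage (f - g) n).toFun 2 leb +
        eLpNorm ((dyadicAverage g n).toFun - g) 2 leb) + eLpNorm (f - g) 2 leb := by
        gcongr
        exact eLpNorm_add_le hC.1 (hB.sub hgm).1 one_le_two
    _ ≤ (ε / 3 + ε / 3) + ε / 3 := by
        gcongr
        exact (eLpNorm_dyadicAverage_le (hf.sub hgm) n).trans hfg
    _ = ε := ENNReal.add_thirds ε

lemma integral_zero_dyadic_dyadicAverage {f : ℝ → ℝ} (hf : Integrable f leb) {m K : ℕ}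
    (hK : K ≤ 2 ^ m) :
    ∫ t in (0 : ℝ)..((K : ℝ) / 2 ^ m), (dyadicAverage f m).toFun t =
      ∫ t in (0 : ℝ)..((K : ℝ) / 2 ^ m), f t := by
  have hA := ((dyadicAverage f m).memLp_toFun 2).integrable one_le_two
  have h (g : ℝ → ℝ) (hg : Integrable g leb) := intervalIntegral.sum_integral_adjacent_intervals
    (μ := volume) (f := g) (a := fun k : ℕ => (k : ℝ) / 2 ^ m) (n := K) (fun k hk => by
      push_cast
      exact intervalIntegrable_of_leb hg (uIcc_dyadic_subset (hk.trans_le hK)))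
  simp only [Nat.cast_add, Nat.cast_one, Nat.cast_zero, zero_div] at h
  rw [← h _ hA, ← h _ hf]
  refine Finset.sum_congr rfl fun k hk => ?_
  exact integral_dyadic_dyadicAverage f ((Finset.mem_range.1 hk).trans_le hK)

/-- Coarse dyadic endpoints are also fine ones, and averaging at the fine level preserves primitives
at its own endpoints. -/
lemma integral_dyadic_dyadicAverage_of_le {f : ℝ → ℝ} (hf : Integrable f leb) {n m k : ℕ}
    (hnm : n ≤ m) (hk : k < 2 ^ n) :
    ∫ t in ((k : ℝ) / 2 ^ n)..((k + 1 : ℝ) / 2 ^ n), (dyadicAverage f m).toFun t =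
      ∫ t in ((k : ℝ) / 2 ^ n)..((k + 1 : ℝ) / 2 ^ n), f t := by
  have hA := ((dyadicAverage f m).memLp_toFun 2).integrable one_le_two
  have h0 (K : ℕ) (hK : K ≤ 2 ^ n) :
      ∫ t in (0 : ℝ)..((K : ℝ) / 2 ^ n), (dyadicAverage f m).toFun t =
        ∫ t in (0 : ℝ)..((K : ℝ) / 2 ^ n), f t := by
    obtain ⟨d, rfl⟩ := Nat.exists_eq_add_of_le hnm
    have h1 : (K : ℝ) / 2 ^ n = ((K * 2 ^ d : ℕ) : ℝ) / 2 ^ (n + d) := by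
      push_cast
      rw [pow_add]
      field_simp
    rw [h1]
    exact integral_zero_dyadic_dyadicAverage hf (by rw [pow_add]; gcongr)
  have hsub (K : ℕ) (hK : K ≤ 2 ^ n) : Set.uIcc (0 : ℝ) (K / 2 ^ n) ⊆ Set.Icc 0 1 := by
    have := dyadic_mem_Icc hK
    rw [Set.uIcc_of_le this.1]
    exact Set.Icc_subset_Icc_right this.2
  have h2 (g : ℝ → ℝ) (hg : Integrable g leb) := intervalIntegral.integral_interval_sub_left
    (intervalIntegrable_of_leb hg (hsub (k + 1) hk)) (intervalIntegrable_of_leb hg (hsub k hk.le))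
  have h3 := h0 (k + 1) hk
  push_cast at h2 h3
  rw [← h2 _ hA, ← h2 _ hf, h3, h0 k hk.le]

/-- The tower property of nested projections, which makes successive increments orthogonal to the
past. -/
lemma integral_dyadicAverage_mul_dyadicAverage {f : ℝ → ℝ} (hf : MemLp f 2 leb) {n m : ℕ}
    (hnm : n ≤ m) : ∫ t, (dyadicAverage f n).toFun t * (dyadicAverage f m).toFun t ∂leb =
      ∫ t, (dyadicAverage f n).toFun t * f t ∂leb := by
  rw [integral_dyadicAverage_mul f hf, integral_dyadicAverage_mul f (StepFunction.memLp_toFun _ 2)]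
  refine Finset.sum_congr rfl fun k hk => ?_
  rw [integral_dyadic_dyadicAverage_of_le (hf.integrable one_le_two) hnm (Finset.mem_range.1 hk)]

/-! ### Almost sure convergence by martingales -/

variable {γ : Measure PathSpace}

/-- The elementary integrals of the dyadic averages are adapted to this filtration. -/
noncomputable def dyadicFiltration (f : ℝ → ℝ) :
    Filtration ℕ (instMeasurableSpacePathSpace) :=
  Filtration.natural (fun n => (dyadicAverage f n).elemIntegral)
    fun _ => (StepFunction.measurable_elemIntegral _).stronglyMeasurable

/-- Jointly Gaussian and uncorrelated implies independent: for `j ≤ n` the products of `Xⱼ` with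
`Xₙ₊₁` and with `Xₙ` both integrate to `∫ Aⱼf · f`. -/
lemma indepFun_elemIntegral_sub (hγ : IsWienerMeasure γ) {f : ℝ → ℝ} (hf : MemLp f 2 leb) (n : ℕ) :
    IndepFun ((dyadicAverage f (n + 1)).elemIntegral - (dyadicAverage f n).elemIntegral)
      (fun w (j : Set.Iic n) => (dyadicAverage f j).elemIntegral w) γ := by
  classical
  have := hγ.isProbabilityMeasure
  set X : ℕ → PathSpace → ℝ := fun j => (dyadicAverage f j).elemIntegral with hX
  have hXm (j : ℕ) : Measurable (X j) := StepFunction.measurable_elemIntegral _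
  have hX2 (j : ℕ) : MemLp (X j) 2 γ := StepFunction.memLp_elemIntegral hγ _
  have hG : IsGaussianProcess (Sum.elim (fun _ : Unit => X (n + 1) - X n)
      (fun j : Set.Iic n => X j)) γ := by
    have hE := StepFunction.isGaussianProcess_elemIntegral hγ
    refine hE.of_isGaussianProcess fun s => ?_
    rcases s with s | j
    · refine ⟨{dyadicAverage f (n + 1), dyadicAverage f n},
        ContinuousLinearMap.proj (R := ℝ) (⟨dyadicAverage f (n + 1), by simp⟩) -
          ContinuousLinearMap.proj (R := ℝ) (⟨dyadicAverage f n, by simp⟩), fun w => ?_⟩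
      simp [hX]
    · refine ⟨{dyadicAverage f j},
        ContinuousLinearMap.proj (R := ℝ) (⟨dyadicAverage f j, by simp⟩), fun w => ?_⟩
      simp [hX]
  have h := hG.indepFun_of_covariance_eq_zero (fun _ => ((hXm _).sub (hXm _)).aemeasurable)
    (fun j => (hXm j).aemeasurable) (fun _ j => ?_)
  · exact h.comp (φ := fun x : Unit → ℝ => x ()) (measurable_pi_apply _) measurable_id
  · have hj : (j : ℕ) ≤ n := j.2
    rw [covariance_comm, covariance_sub_right (hX2 _) (hX2 _) (hX2 _),
      covariance_eq_sub (hX2 _) (hX2 _), covariance_eq_sub (hX2 _) (hX2 _)]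
    simp only [hX, Pi.mul_apply, StepFunction.integral_elemIntegral hγ,
      StepFunction.integral_elemIntegral_mul hγ]
    rw [integral_dyadicAverage_mul_dyadicAverage hf hj,
      integral_dyadicAverage_mul_dyadicAverage hf (hj.trans n.le_succ)]
    simp

lemma martingale_elemIntegral (hγ : IsWienerMeasure γ) {f : ℝ → ℝ} (hf : MemLp f 2 leb) :
    Martingale (fun n => (dyadicAverage f n).elemIntegral) (dyadicFiltration f) γ := by
  have := hγ.isProbabilityMeasure
  have hi (n : ℕ) : Integrable (dyadicAverage f n).elemIntegral γ :=
    (StepFunction.memLp_elemIntegral hγ _).integrable one_le_two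
  have hm (n : ℕ) := StepFunction.measurable_elemIntegral (dyadicAverage f n)
  refine martingale_of_condExp_sub_eq_zero_nat (Filtration.stronglyAdapted_natural _) hi fun n => ?_
  have hd : Measurable
      ((dyadicAverage f (n + 1)).elemIntegral - (dyadicAverage f n).elemIntegral) :=
    (hm _).sub (hm _)
  have hind := indepFun_elemIntegral_sub hγ hf n
  rw [IndepFun_iff_Indep] at hind
  -- The natural filtration at time `n` is generated by the variables up to `n`, so the conditional
  -- expectation of the increment is its mean, zero.
  have h := condExp_indep_eq (μ := γ) hd.comap_le ((dyadicFiltration f).le n)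
    (comap_measurable _).stronglyMeasurable (by
      rw [dyadicFiltration, Filtration.natural_eq_comap]
      exact hind)
  refine h.trans (ae_of_all _ fun w => ?_)
  simp only [Pi.zero_apply]
  rw [integral_sub' (hi _) (hi _)]
  simp [StepFunction.integral_elemIntegral hγ]

lemma eLpNorm_elemIntegral (hγ : IsWienerMeasure γ) (s : StepFunction) :
    eLpNorm s.elemIntegral 2 γ = eLpNorm s.toFun 2 leb := by
  rw [eLpNorm_two_eq_sqrt (StepFunction.memLp_elemIntegral hγ s),
    eLpNorm_two_eq_sqrt (s.memLp_toFun 2)]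
  simp only [pow_two, StepFunction.integral_elemIntegral_mul hγ]

/-- Martingale convergence: on a probability space the `L¹` norms are below the `L²` norms, which
isometry and contraction bound by `‖f‖₂`. -/
lemma ae_exists_tendsto_elemIntegral (hγ : IsWienerMeasure γ) {f : ℝ → ℝ} (hf : MemLp f 2 leb) :
    ∀ᵐ w ∂γ, ∃ c, Tendsto (fun n => (dyadicAverage f n).elemIntegral w) atTop (𝓝 c) := by
  have := hγ.isProbabilityMeasure
  refine (martingale_elemIntegral hγ hf).submartingale.exists_ae_tendsto_of_bdd
    (R := (eLpNorm f 2 leb).toNNReal) fun n => ?_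
  rw [ENNReal.coe_toNNReal hf.2.ne]
  calc _ ≤ eLpNorm (dyadicAverage f n).elemIntegral 2 γ :=
        eLpNorm_le_eLpNorm_of_exponent_le one_le_two
          (StepFunction.measurable_elemIntegral _).aestronglyMeasurable
    _ = eLpNorm (dyadicAverage f n).toFun 2 leb := eLpNorm_elemIntegral hγ _
    _ ≤ _ := eLpNorm_dyadicAverage_le hf n

/-! ### The functional `[h]` as a limit of elementary integrals -/

lemma pathExt_of_mem (w : PathSpace) {t : ℝ} (ht : t ∈ Set.Icc (0 : ℝ) 1) :
    pathExt w t = w.1 ⟨t, ht⟩ :=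
  Set.IccExtend_of_mem _ _ ht

/-- The fundamental theorem of calculus for absolutely continuous functions; it identifies
`dyadicIntegral` with the elementary integral of the averages of `ḣ`. -/
lemma dyadicMean_pathDeriv {h : PathSpace} (hh : h ∈ cmSpace) {n k : ℕ} (hk : k < 2 ^ n) :
    dyadicMean (pathDeriv h) n k =
      2 ^ n * (pathExt h ((k + 1 : ℝ) / 2 ^ n) - pathExt h ((k : ℝ) / 2 ^ n)) := by
  rw [dyadicMean, pathDeriv, AbsolutelyContinuousOnInterval.integral_deriv_eq_sub (hh.1.mono ?_)]
  rw [Set.uIcc_of_le zero_le_one]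
  exact uIcc_dyadic_subset hk

lemma elemIntegral_dyadicAverage_pathDeriv {h : PathSpace} (hh : h ∈ cmSpace) (n : ℕ)
    (w : PathSpace) : (dyadicAverage (pathDeriv h) n).elemIntegral w = dyadicIntegral h n w := by
  rw [dyadicIntegral, Finset.sum_range]
  refine Finset.sum_congr rfl fun k _ => ?_
  rw [← dyadicMean_pathDeriv hh k.2, pathExt_of_mem w (dyadic_succ_mem_Icc k.2),
    pathExt_of_mem w (dyadic_mem_Icc k.2.le)]
  have h1 : (dyadicAverage (pathDeriv h) n).t k.succ =
      ⟨(k + 1 : ℝ) / 2 ^ n, dyadic_succ_mem_Icc k.2⟩ :=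
    Subtype.ext (by
      show ((k.succ : ℕ) : ℝ) / 2 ^ n = _
      rw [Fin.val_succ, Nat.cast_add_one])
  rw [h1]
  rfl

/-- Whatever extension was chosen, it agrees with the limit on the convergence space. -/
lemma wienerIntegral_eq_of_tendsto {h w : PathSpace} {l : ℝ}
    (hl : Tendsto (fun n => dyadicIntegral h n w) atTop (𝓝 l)) : wienerIntegral h w = l := by
  have h1 := LinearMap.congr_fun (Classical.choose_spec (LinearMap.exists_extend (dyadicLimit h)))
    (⟨w, l, hl⟩ : convergenceSpace h)
  exact h1.trans hl.limUnder_eq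

lemma ae_tendsto_wienerIntegral (hγ : IsWienerMeasure γ) {h : PathSpace} (hh : h ∈ cmSpace) :
    ∀ᵐ w ∂γ, Tendsto (fun n => (dyadicAverage (pathDeriv h) n).elemIntegral w) atTop
      (𝓝 (wienerIntegral h w)) := by
  filter_upwards [ae_exists_tendsto_elemIntegral hγ hh.2] with w ⟨c, hc⟩
  have hc' := hc
  simp only [elemIntegral_dyadicAverage_pathDeriv hh] at hc'
  rwa [wienerIntegral_eq_of_tendsto hc']

lemma aestronglyMeasurable_wienerIntegral (hγ : IsWienerMeasure γ) {h : PathSpace}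
    (hh : h ∈ cmSpace) : AEStronglyMeasurable (wienerIntegral h) γ :=
  aestronglyMeasurable_of_tendsto_ae atTop
    (fun _ => (StepFunction.measurable_elemIntegral _).aestronglyMeasurable)
    (ae_tendsto_wienerIntegral hγ hh)

/-- Fatou along the almost sure dyadic limit, then the isometry at each level and the triangle
inequality through `ḣ`. This one bound yields both square integrability and convergence for
arbitrary approximating step functions. -/
lemma eLpNorm_elemIntegral_sub_wienerIntegral_le (hγ : IsWienerMeasure γ) {h : PathSpace}
    (hh : h ∈ cmSpace) (s : StepFunction) :
    eLpNorm (fun w => s.elemIntegral w - wienerIntegral h w) 2 γ ≤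
      eLpNorm (fun u => s.toFun u - pathDeriv h u) 2 leb := by
  have hs := s.memLp_toFun 2
  have hlim : ∀ᵐ w ∂γ, Tendsto
      (fun n => s.elemIntegral w - (dyadicAverage (pathDeriv h) n).elemIntegral w) atTop
      (𝓝 (s.elemIntegral w - wienerIntegral h w)) := by
    filter_upwards [ae_tendsto_wienerIntegral hγ hh] with w hw using hw.const_sub _
  have hbd : Tendsto (fun n => eLpNorm (fun u => s.toFun u - pathDeriv h u) 2 leb +
      eLpNorm (fun u => (dyadicAverage (pathDeriv h) n).toFun u - pathDeriv h u) 2 leb) atTop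
      (𝓝 (eLpNorm (fun u => s.toFun u - pathDeriv h u) 2 leb)) := by
    simpa using tendsto_const_nhds.add (tendsto_dyadicAverage hh.2)
  refine (Lp.eLpNorm_lim_le_liminf_eLpNorm (fun n => ((StepFunction.measurable_elemIntegral _).sub
    (StepFunction.measurable_elemIntegral _)).aestronglyMeasurable) _ hlim).trans ?_
  rw [← hbd.liminf_eq]
  refine liminf_le_liminf (Eventually.of_forall fun n => ?_)
  refine (StepFunction.eLpNorm_elemIntegral_sub hγ _ _).trans_le ?_
  have hA := (dyadicAverage (pathDeriv h) n).memLp_toFun 2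
  have h1 : (fun u => s.toFun u - (dyadicAverage (pathDeriv h) n).toFun u) =
      (fun u => s.toFun u - pathDeriv h u) -
        fun u => (dyadicAverage (pathDeriv h) n).toFun u - pathDeriv h u := by
    ext u
    simp
  rw [h1]
  exact eLpNorm_sub_le (hs.sub hh.2).1 (hA.sub hh.2).1 one_le_two

lemma memLp_wienerIntegral (hγ : IsWienerMeasure γ) {h : PathSpace} (hh : h ∈ cmSpace) :
    MemLp (wienerIntegral h) 2 γ := by
  -- Any step function would serve here.
  set s := dyadicAverage (pathDeriv h) 0
  have h1 : MemLp (fun w => s.elemIntegral w - wienerIntegral h w) 2 γ :=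
    ⟨(StepFunction.measurable_elemIntegral _).aestronglyMeasurable.sub
      (aestronglyMeasurable_wienerIntegral hγ hh),
      (eLpNorm_elemIntegral_sub_wienerIntegral_le hγ hh s).trans_lt
        ((s.memLp_toFun 2).sub hh.2).2⟩
  have h2 := (StepFunction.memLp_elemIntegral hγ s).sub h1
  convert! h2 using 1
  ext w
  simp

theorem isWienerIntegral_wienerIntegral (hγ : IsWienerMeasure γ) {h : PathSpace}
    (hh : h ∈ cmSpace) : IsWienerIntegral γ (pathDeriv h) (wienerIntegral h) :=
  ⟨memLp_wienerIntegral hγ hh, fun s hs => tendsto_of_tendsto_of_tendsto_of_le_of_le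
    tendsto_const_nhds hs (fun _ => zero_le)
    fun k => eLpNorm_elemIntegral_sub_wienerIntegral_le hγ hh (s k)⟩

/-! ### Passing to the limit in `L²` products and Gaussian laws -/

section L2

variable {α : Type*} {mα : MeasurableSpace α} {μ : Measure α}

/-- Continuity of the `L²` inner product, in terms of functions. -/
lemma tendsto_integral_mul_of_eLpNorm {f g : ℕ → α → ℝ} {F G : α → ℝ} (hf : ∀ n, MemLp (f n) 2 μ)
    (hg : ∀ n, MemLp (g n) 2 μ) (hF : MemLp F 2 μ) (hG : MemLp G 2 μ)
    (hfF : Tendsto (fun n => eLpNorm (f n - F) 2 μ) atTop (𝓝 0))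
    (hgG : Tendsto (fun n => eLpNorm (g n - G) 2 μ) atTop (𝓝 0)) :
    Tendsto (fun n => ∫ x, f n x * g n x ∂μ) atTop (𝓝 (∫ x, F x * G x ∂μ)) := by
  have h1 := (Lp.tendsto_Lp_iff_tendsto_eLpNorm'' f hf F hF).2 hfF
  have h2 := (Lp.tendsto_Lp_iff_tendsto_eLpNorm'' g hg G hG).2 hgG
  have key {u v : α → ℝ} (hu : MemLp u 2 μ) (hv : MemLp v 2 μ) :
      inner ℝ (hu.toLp u) (hv.toLp v) = ∫ x, u x * v x ∂μ := by
    rw [L2.inner_def]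
    refine integral_congr_ae ?_
    filter_upwards [hu.coeFn_toLp, hv.coeFn_toLp] with x hx hy
    rw [hx, hy]
    simp [mul_comm]
  have h3 := h1.inner (𝕜 := ℝ) h2
  simpa only [key] using h3

lemma tendsto_eLpNorm_finset_sum {ι : Type*} (s : Finset ι) (c : ι → ℝ) {f : ℕ → ι → α → ℝ}
    {F : ι → α → ℝ} (hf : ∀ n i, MemLp (f n i) 2 μ) (hF : ∀ i, MemLp (F i) 2 μ)
    (h : ∀ i, Tendsto (fun n => eLpNorm (f n i - F i) 2 μ) atTop (𝓝 0)) :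
    Tendsto (fun n => eLpNorm (∑ i ∈ s, c i • f n i - ∑ i ∈ s, c i • F i) 2 μ) atTop (𝓝 0) := by
  have hbd : Tendsto (fun n => ∑ i ∈ s, ‖c i‖ₑ * eLpNorm (f n i - F i) 2 μ) atTop (𝓝 0) := by
    have := tendsto_finsetSum s fun i _ => ENNReal.Tendsto.const_mul (a := ‖c i‖ₑ) (h i)
      (Or.inr enorm_ne_top)
    simpa using this
  refine tendsto_of_tendsto_of_tendsto_of_le_of_le tendsto_const_nhds hbd (fun _ => zero_le)
    fun n => ?_
  rw [← Finset.sum_sub_distrib]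
  refine (eLpNorm_sum_le (fun i _ => (((hf n i).const_smul _).sub ((hF i).const_smul _)).1)
    one_le_two).trans ?_
  refine Finset.sum_le_sum fun i _ => ?_
  rw [← smul_sub, eLpNorm_const_smul]

end L2

section GaussianLimit

variable {Ω : Type*} {mΩ : MeasurableSpace Ω} {P : Measure Ω} [IsProbabilityMeasure P]

/-- A limit of real Gaussian variables, almost sure and in `L²`, is Gaussian. -/
lemma hasGaussianLaw_of_tendsto {Y : ℕ → Ω → ℝ} {Z : Ω → ℝ} (hY : ∀ n, HasGaussianLaw (Y n) P)
    (hZ : MemLp Z 2 P) (hae : ∀ᵐ ω ∂P, Tendsto (fun n => Y n ω) atTop (𝓝 (Z ω)))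
    (hL2 : Tendsto (fun n => eLpNorm (Y n - Z) 2 P) atTop (𝓝 0)) : HasGaussianLaw Z P := by
  have hZm : AEMeasurable Z P := hZ.1.aemeasurable
  have hY2 (n : ℕ) : MemLp (Y n) 2 P := (hY n).memLp_two
  have hmean : Tendsto (fun n => P[Y n]) atTop (𝓝 P[Z]) := by
    -- Pairing with the constant `1` turns continuity of the inner product into convergence of
    -- means.
    have := tendsto_integral_mul_of_eLpNorm hY2 (fun _ => memLp_const (1 : ℝ)) hZ
      (memLp_const 1) hL2 (by simp)
    simpa using this
  have hvar : Tendsto (fun n => Var[Y n; P]) atTop (𝓝 Var[Z; P]) := by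
    have := tendsto_integral_mul_of_eLpNorm hY2 hY2 hZ hZ hL2 hL2
    rw [variance_eq_sub hZ]
    simp_rw [variance_eq_sub (hY2 _)]
    refine Tendsto.sub ?_ (hmean.pow 2)
    simpa only [Pi.pow_apply, pow_two] using this
  rw [hasGaussianLaw_iff_charFun_map_eq hZm]
  intro t
  have hchar (X : Ω → ℝ) (hX : AEMeasurable X P) :
      charFun (P.map X) t = ∫ ω, Complex.exp (t * X ω * Complex.I) ∂P := by
    rw [charFun_apply_real, integral_map hX (by fun_prop)]
  have hinner (X : Ω → ℝ) : (P[fun ω => inner ℝ t (X ω)] : ℝ) = t * P[X] ∧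
      Var[fun ω => inner ℝ t (X ω); P] = t ^ 2 * Var[X; P] := by
    have : (fun ω => inner ℝ t (X ω)) = fun ω => t * X ω := by
      ext ω
      simp [mul_comm]
    rw [this]
    exact ⟨integral_const_mul _ _, variance_const_mul _ _ _⟩
  -- Characteristic functions converge by dominated convergence with bound `1`; convergence of mean
  -- and variance then identifies the limit as Gaussian.
  have h1 : Tendsto (fun n => charFun (P.map (Y n)) t) atTop (𝓝 (charFun (P.map Z) t)) := by
    rw [hchar Z hZm]
    simp_rw [fun n => hchar (Y n) (hY n).aemeasurable]
    refine tendsto_integral_of_dominated_convergence (fun _ => 1) (fun n => ?_)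
      (integrable_const _) (fun n => ae_of_all _ fun ω => ?_) ?_
    · have := (hY n).aemeasurable
      exact AEMeasurable.aestronglyMeasurable (by fun_prop)
    · rw [← Complex.ofReal_mul, Complex.norm_exp_ofReal_mul_I]
    · filter_upwards [hae] with ω hω
      have hc : Continuous fun x : ℝ => Complex.exp (t * x * Complex.I) := by fun_prop
      exact (hc.tendsto _).comp hω
  have hchar' (X : Ω → ℝ) (hX : HasGaussianLaw X P) : charFun (P.map X) t =
      Complex.exp (((t * P[X] : ℝ) : ℂ) * Complex.I - ((t ^ 2 * Var[X; P] : ℝ) : ℂ) / 2) := by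
    rw [hX.charFun_map_eq t, (hinner X).1, (hinner X).2]
  have hc : Continuous fun p : ℝ × ℝ =>
      Complex.exp (((t * p.1 : ℝ) : ℂ) * Complex.I - ((t ^ 2 * p.2 : ℝ) : ℂ) / 2) := by fun_prop
  have h2 := (hc.tendsto (P[Z], Var[Z; P])).comp (hmean.prodMk_nhds hvar)
  rw [(hinner Z).1, (hinner Z).2]
  refine tendsto_nhds_unique h1 (h2.congr fun n => ?_)
  exact (hchar' (Y n) (hY n)).symm

/-- A limit of Gaussian processes, almost sure and in `L²` at each time, is Gaussian. -/
lemma isGaussianProcess_of_tendsto {T : Type*} {Y : ℕ → T → Ω → ℝ} {Z : T → Ω → ℝ}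
    (hY : ∀ n, IsGaussianProcess (Y n) P) (hZ : ∀ t, MemLp (Z t) 2 P)
    (hae : ∀ t, ∀ᵐ ω ∂P, Tendsto (fun n => Y n t ω) atTop (𝓝 (Z t ω)))
    (hL2 : ∀ t, Tendsto (fun n => eLpNorm (Y n t - Z t) 2 P) atTop (𝓝 0)) :
    IsGaussianProcess Z P where
  hasGaussianLaw I := by
    classical
    have hm : AEMeasurable (fun ω => I.restrict (Z · ω)) P :=
      aemeasurable_pi_lambda _ fun i => (hZ i).1.aemeasurable
    -- Gaussianity of a vector is tested on linear functionals `L`; each is a finite linear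
    -- combination of coordinates, to which the scalar case applies.
    refine ⟨⟨fun L => ?_⟩⟩
    set c : I → ℝ := fun i => L (Pi.single i 1) with hc
    have hL (x : I → ℝ) : L x = ∑ i, c i * x i := by
      conv_lhs => rw [pi_eq_sum_univ' x, map_sum]
      refine Finset.sum_congr rfl fun i _ => ?_
      rw [map_smul, smul_eq_mul, mul_comm, hc]
    have hLY (X : T → Ω → ℝ) : (L ∘ fun ω => I.restrict (X · ω)) = ∑ i : I, c i • X i := by
      ext ω
      simp [hL]
    have hG : HasGaussianLaw (L ∘ fun ω => I.restrict (Z · ω)) P := by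
      refine hasGaussianLaw_of_tendsto (Y := fun n => L ∘ fun ω => I.restrict (Y n · ω))
        (fun n => ((hY n).hasGaussianLaw I).map L) ?_ ?_ ?_
      · rw [hLY]
        exact memLp_finsetSum' _ fun i _ => (hZ i).const_smul _
      · have h : ∀ᵐ ω ∂P, ∀ i : I, Tendsto (fun n => Y n i ω) atTop (𝓝 (Z i ω)) :=
          ae_all_iff.2 fun i => hae i
        filter_upwards [h] with ω hω
        exact (L.continuous.tendsto _).comp (tendsto_pi_nhds.2 hω)
      · simp only [hLY]
        exact tendsto_eLpNorm_finset_sum _ _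
          (fun n i => ((hY n).hasGaussianLaw_eval i).memLp_two) (fun i => hZ i) fun i => hL2 i
    have := hG.map_eq_gaussianReal
    rw [AEMeasurable.map_map_of_aemeasurable L.continuous.aemeasurable hm, this,
      integral_map hm L.continuous.aestronglyMeasurable,
      variance_map L.continuous.aemeasurable hm]
    rfl

end GaussianLimit

/-! ### Joint law of the Wiener integrals and their values on `𝓗` -/

lemma tendsto_elemIntegral_wienerIntegral (hγ : IsWienerMeasure γ) {h : PathSpace}
    (hh : h ∈ cmSpace) :
    Tendsto (fun n => eLpNorm ((dyadicAverage (pathDeriv h) n).elemIntegral -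
      ⇑(wienerIntegral h)) 2 γ) atTop (𝓝 0) :=
  (isWienerIntegral_wienerIntegral hγ hh).2 _ (tendsto_dyadicAverage hh.2)

/-- The Wiener integrals form a Gaussian process indexed by the Cameron-Martin space. -/
theorem isGaussianProcess_wienerIntegral (hγ : IsWienerMeasure γ) :
    IsGaussianProcess (fun (h : cmSpace) (w : PathSpace) => wienerIntegral h w) γ := by
  have := hγ.isProbabilityMeasure
  refine isGaussianProcess_of_tendsto
    (Y := fun n (h : cmSpace) => (dyadicAverage (pathDeriv h) n).elemIntegral) (fun n => ?_)
    (fun h => memLp_wienerIntegral hγ h.2) (fun h => ae_tendsto_wienerIntegral hγ h.2)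
    (fun h => tendsto_elemIntegral_wienerIntegral hγ h.2)
  exact (StepFunction.isGaussianProcess_elemIntegral hγ).comp_right
    fun h : cmSpace => dyadicAverage (pathDeriv h) n

lemma integral_wienerIntegral (hγ : IsWienerMeasure γ) {h : PathSpace} (hh : h ∈ cmSpace) :
    ∫ w, wienerIntegral h w ∂γ = 0 := by
  have := hγ.isProbabilityMeasure
  have h1 := tendsto_integral_mul_of_eLpNorm (fun n => StepFunction.memLp_elemIntegral hγ _)
    (fun _ => memLp_const (1 : ℝ)) (memLp_wienerIntegral hγ hh) (memLp_const 1)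
    (tendsto_elemIntegral_wienerIntegral hγ hh) (by simp)
  simp only [mul_one, StepFunction.integral_elemIntegral hγ] at h1
  exact tendsto_nhds_unique h1 tendsto_const_nhds

lemma integral_wienerIntegral_mul (hγ : IsWienerMeasure γ) {h k : PathSpace} (hh : h ∈ cmSpace)
    (hk : k ∈ cmSpace) : ∫ w, wienerIntegral h w * wienerIntegral k w ∂γ = cmInner h k := by
  have h1 := tendsto_integral_mul_of_eLpNorm (fun n => StepFunction.memLp_elemIntegral hγ _)
    (fun n => StepFunction.memLp_elemIntegral hγ _) (memLp_wienerIntegral hγ hh)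
    (memLp_wienerIntegral hγ hk) (tendsto_elemIntegral_wienerIntegral hγ hh)
    (tendsto_elemIntegral_wienerIntegral hγ hk)
  simp only [StepFunction.integral_elemIntegral_mul hγ] at h1
  rw [cmInner, ← integral_leb]
  exact tendsto_nhds_unique h1 (tendsto_integral_mul_of_eLpNorm
    (fun n => StepFunction.memLp_toFun _ 2) (fun n => StepFunction.memLp_toFun _ 2) hh.2 hk.2
    (tendsto_dyadicAverage hh.2) (tendsto_dyadicAverage hk.2))

/-- On the Cameron-Martin space the Wiener integral is the inner product. -/
lemma wienerIntegral_apply_of_mem {h θ : PathSpace} (hh : h ∈ cmSpace) (hθ : θ ∈ cmSpace) :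
    wienerIntegral h θ = cmInner h θ := by
  -- An almost sure statement says nothing at the single path `θ`. There the dyadic sums are `∫ Aₙḣ
  -- · θ̇`, since increments of `θ` integrate `θ̇`, and they converge.
  refine wienerIntegral_eq_of_tendsto ?_
  have h1 (n : ℕ) : dyadicIntegral h n θ =
      ∫ t, (dyadicAverage (pathDeriv h) n).toFun t * pathDeriv θ t ∂leb := by
    rw [integral_dyadicAverage_mul _ hθ.2, dyadicIntegral]
    refine Finset.sum_congr rfl fun k hk => ?_
    rw [← dyadicMean_pathDeriv hh (Finset.mem_range.1 hk)]
    have := dyadicMean_pathDeriv hθ (Finset.mem_range.1 hk)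
    rw [dyadicMean, mul_right_inj' (by positivity)] at this
    rw [this]
  simp only [h1]
  rw [cmInner, ← integral_leb]
  exact tendsto_integral_mul_of_eLpNorm (fun n => StepFunction.memLp_toFun _ 2)
    (fun _ => hθ.2) hh.2 hθ.2 (tendsto_dyadicAverage hh.2) (by simp)

/-! ### Hermite generating function -/

section Hermite

/-- The `n`-th derivative of the complex Gaussian is a Hermite polynomial times the Gaussian. -/
lemma iteratedDeriv_cexp_gaussian (n : ℕ) :
    iteratedDeriv n (fun z : ℂ => Complex.exp (-z ^ 2 / 2)) =
      fun z => (-1) ^ n * Polynomial.aeval z (Polynomial.hermite n) *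
        Complex.exp (-z ^ 2 / 2) := by
  induction n with
  | zero => ext z; simp
  | succ n ih =>
    rw [iteratedDeriv_succ, ih]
    ext z
    have h1 : HasDerivAt (fun z : ℂ => Polynomial.aeval z (Polynomial.hermite n))
        (Polynomial.aeval z (Polynomial.derivative (Polynomial.hermite n))) z :=
      Polynomial.hasDerivAt_aeval _ z
    have h2 : HasDerivAt (fun z : ℂ => Complex.exp (-z ^ 2 / 2))
        (Complex.exp (-z ^ 2 / 2) * (-z)) z := by
      have := (((hasDerivAt_id z).pow 2).neg.div_const 2).cexp
      convert! this using 1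
      simp
      ring
    refine ((h1.const_mul ((-1) ^ n)).mul h2).deriv.trans ?_
    rw [Polynomial.hermite_succ]
    simp only [map_sub, map_mul, Polynomial.aeval_X]
    ring

/-- The generating function of the Hermite polynomials at `λ = 1`. -/
lemma hasSum_hermite (x : ℝ) :
    HasSum (fun n : ℕ => (1 / (n.factorial : ℝ)) * H n x) (Real.exp (x - 1 / 2)) := by
  have hd : Differentiable ℂ fun z : ℂ => Complex.exp (-z ^ 2 / 2) := by fun_prop
  -- Expand the entire function `exp(-z²/2)` about `x` and evaluate at `x - 1`: the factor `(-1)ⁿ`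
  -- from the increment cancels the sign in the `n`-th derivative, and multiplying by `exp(x²/2)`
  -- leaves `exp(x - 1/2)`.
  have h := (Complex.hasSum_taylorSeries_of_entire hd (x : ℂ) ((x : ℂ) - 1)).mul_right
    (Complex.exp ((x : ℂ) ^ 2 / 2))
  rw [← Complex.hasSum_ofReal]
  convert! h using 1
  · ext n
    have hH : ((H n x : ℝ) : ℂ) = Polynomial.aeval (x : ℂ) (Polynomial.hermite n) := by
      rw [H, ← Complex.coe_algebraMap, Polynomial.aeval_algebraMap_apply]
    have he : Complex.exp (-(x : ℂ) ^ 2 / 2) * Complex.exp ((x : ℂ) ^ 2 / 2) = 1 := by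
      rw [← Complex.exp_add]
      ring_nf
      simp
    have hs : ((-1 : ℂ) ^ n) * (-1) ^ n = 1 := by rw [← mul_pow]; simp
    simp only [iteratedDeriv_cexp_gaussian, sub_sub_cancel_left, smul_eq_mul, Complex.ofReal_mul,
      Complex.ofReal_natCast, hH, one_div,
      Complex.ofReal_inv]
    linear_combination (-(n.factorial : ℂ)⁻¹ * Polynomial.aeval (x : ℂ) (Polynomial.hermite n)) * hs
      - ((n.factorial : ℂ)⁻¹ * Polynomial.aeval (x : ℂ) (Polynomial.hermite n) *
        ((-1 : ℂ) ^ n * (-1) ^ n)) * he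
  · rw [← Complex.exp_add, Complex.ofReal_exp]
    congr 1
    push_cast
    ring

lemma H_eq_eval (n : ℕ) (x : ℝ) :
    H n x = ((Polynomial.hermite n).map (Int.castRingHom ℝ)).eval x := by
  rw [H, Polynomial.aeval_def, Polynomial.eval₂_eq_eval_map, algebraMap_int_eq]

end Hermite

/-! ### Calculus along lines in direction `θ` -/

section Derivatives

open Polynomial in
-- The derivative is given at every point of the line, not only at `w`, so that `D θ F` again
-- satisfies the hypothesis and the step can be iterated.
lemma hasLineDerivAt_of_eval {F : PathSpace → ℝ} {w θ : PathSpace} {q : ℝ[X]}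
    (h : ∀ t : ℝ, F (w + t • θ) = q.eval t) (t : ℝ) :
    HasLineDerivAt ℝ F ((derivative q).eval t) (w + t • θ) θ := by
  have h1 : HasDerivAt (fun s => q.eval s) ((derivative q).eval (t + 0)) (t + 0) :=
    q.hasDerivAt _
  have h2 := h1.comp_const_add t 0
  rw [add_zero] at h2
  unfold HasLineDerivAt
  convert! h2 using 1
  ext s
  rw [← h, add_smul, add_assoc]

open Polynomial in
lemma iterate_D_eval {θ w : PathSpace} (n : ℕ) : ∀ {F : PathSpace → ℝ} {q : ℝ[X]},
    (∀ t : ℝ, F (w + t • θ) = q.eval t) →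
      ∀ t : ℝ, ((D θ)^[n] F) (w + t • θ) = (derivative^[n] q).eval t := by
  induction n with
  | zero => exact fun h => h
  | succ n ih =>
    intro F q h t
    rw [Function.iterate_succ_apply, Function.iterate_succ_apply]
    exact ih (fun s => (hasLineDerivAt_of_eval h s).lineDeriv) t

open Polynomial in
lemma lineDifferentiableAt_iterate_D {θ w : PathSpace} {F : PathSpace → ℝ} {q : ℝ[X]}
    (h : ∀ t : ℝ, F (w + t • θ) = q.eval t) (n : ℕ) :
    LineDifferentiableAt ℝ ((D θ)^[n] F) w θ := by
  have := hasLineDerivAt_of_eval (iterate_D_eval n h) 0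
  rw [zero_smul, add_zero] at this
  exact this.lineDifferentiableAt

open Polynomial in
/-- `e^{D_θ}` is the translation by `θ` on functionals that are polynomial along `θ`. -/
lemma expOp_D_eq {θ w : PathSpace} {F : PathSpace → ℝ} {q : ℝ[X]}
    (h : ∀ t : ℝ, F (w + t • θ) = q.eval t) : expOp (D θ) F w = F (w + θ) := by
  -- The `n`-th Taylor coefficient at `0` is the `n`-th coefficient of `q`; their sum is `q(1) = F(w
  -- + θ)`.
  have hterm (n : ℕ) : (1 / (n.factorial : ℝ)) * ((D θ)^[n] F) w = q.coeff n := by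
    have := iterate_D_eval n h 0
    rw [zero_smul, add_zero] at this
    rw [this, ← coeff_zero_eq_eval_zero, coeff_iterate_derivative, zero_add,
      Nat.descFactorial_self, nsmul_eq_mul]
    field_simp
  have h1 := h 1
  rw [one_smul] at h1
  rw [expOp, h1, tsum_congr hterm, eval_eq_sum_range,
    tsum_eq_sum (s := Finset.range (q.natDegree + 1))]
  · simp
  · intro n hn
    exact coeff_eq_zero_of_natDegree_lt (by simpa using hn)

end Derivatives

section PolyFunctional

variable {n : ℕ} (h : Fin n → PathSpace) (p : MvPolynomial (Fin n) ℝ)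

/-- The restriction of a polynomial functional to the line through `w` in direction `θ`. -/
noncomputable def linePoly (θ w : PathSpace) : Polynomial ℝ :=
  MvPolynomial.aeval (fun i => Polynomial.C (wienerIntegral (h i) w) +
    Polynomial.C (wienerIntegral (h i) θ) * Polynomial.X) p

/-- The bound does not depend on `w`, so a single power of `D θ` annihilates the functional at all
paths. -/
lemma natDegree_linePoly_le (θ w : PathSpace) :
    (linePoly h p θ w).natDegree ≤ p.totalDegree * 1 := by
  refine MvPolynomial.aeval_natDegree_le p le_rfl _ fun i => ?_
  compute_degree

lemma eval_linePoly (θ w : PathSpace) (t : ℝ) :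
    (linePoly h p θ w).eval t =
      MvPolynomial.eval (fun i => wienerIntegral (h i) (w + t • θ)) p := by
  have h1 (i : Fin n) : wienerIntegral (h i) (w + t • θ) = Polynomial.aeval t
      (Polynomial.C (wienerIntegral (h i) w) +
        Polynomial.C (wienerIntegral (h i) θ) * Polynomial.X) := by
    simp [mul_comm t]
  rw [linePoly, ← Polynomial.coe_aeval_eq_eval, MvPolynomial.comp_aeval_apply,
    MvPolynomial.aeval_eq_eval]
  simp only [h1]

end PolyFunctional

/-! ### Iterates of `D_θ^*` on the constant `1` -/

section Dstar

variable {θ : PathSpace}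

open Polynomial in
lemma eval_comp_hermite (hθ : wienerIntegral θ θ = 1) (n : ℕ) (w : PathSpace) (t : ℝ) :
    H n (wienerIntegral θ (w + t • θ)) =
      (((hermite n).map (Int.castRingHom ℝ)).comp (X + C (wienerIntegral θ w))).eval t := by
  simp [H_eq_eval, hθ, add_comm]

open Polynomial in
lemma hasLineDerivAt_H (hθ : wienerIntegral θ θ = 1) (n : ℕ) (w : PathSpace) :
    HasLineDerivAt ℝ (fun w => H n (wienerIntegral θ w))
      (aeval (wienerIntegral θ w) (derivative (hermite n))) w θ := by
  have := hasLineDerivAt_of_eval (F := fun w => H n (wienerIntegral θ w))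
    (eval_comp_hermite hθ n w) 0
  rw [zero_smul, add_zero] at this
  convert! this using 1
  simp [derivative_comp, aeval_def, eval₂_eq_eval_map, derivative_map]

/-- The iterates of `D_θ^*` on `1` are the Hermite functionals. -/
lemma iterate_Dstar_one (hθ : wienerIntegral θ θ = 1) (n : ℕ) :
    (Dstar θ)^[n] 1 = fun w => H n (wienerIntegral θ w) := by
  induction n with
  | zero => ext w; simp [H]
  | succ n ih =>
    rw [Function.iterate_succ_apply', ih]
    ext w
    -- What remains is the recursion `Hₙ₊₁ = x Hₙ - Hₙ'`.
    rw [Dstar, D, (hasLineDerivAt_H hθ n w).lineDeriv]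
    simp only [H, Polynomial.hermite_succ, map_sub, map_mul, Polynomial.aeval_X]
    ring

lemma H_mem_polyFunctionals (hθ : θ ∈ cmSpace) (n : ℕ) :
    (fun w => H n (wienerIntegral θ w)) ∈ polyFunctionals := by
  refine ⟨1, fun _ => θ, Polynomial.aeval (MvPolynomial.X 0)
    ((Polynomial.hermite n).map (Int.castRingHom ℝ)),
    fun _ => hθ, fun w => ?_⟩
  show H n (wienerIntegral θ w) = _
  rw [H_eq_eval, ← MvPolynomial.aeval_eq_eval]
  rw [← Polynomial.aeval_algHom_apply]
  simp

end Dstar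

/-! ### Finite-dimensional Cameron-Martin formula -/

section Gaussian

/-- The Cameron-Martin formula for the standard Gaussian measure on the line. -/
lemma integral_gaussianReal_mul_exp (g : ℝ → ℝ) :
    ∫ y, g y * Real.exp (y - 1 / 2) ∂(gaussianReal 0 1) = ∫ y, g (y + 1) ∂(gaussianReal 0 1) := by
  rw [integral_gaussianReal_eq_integral_smul one_ne_zero,
    integral_gaussianReal_eq_integral_smul one_ne_zero,
    -- After the shift `y ↦ y - 1`, completing the square gives `φ(y - 1) = φ(y) exp(y - 1/2)` for
    -- the standard density `φ`.
    ← integral_sub_right_eq_self (fun y => gaussianPDFReal 0 1 y • g (y + 1)) (1 : ℝ)]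
  refine integral_congr_ae (ae_of_all _ fun y => ?_)
  simp only [gaussianPDFReal, smul_eq_mul, sub_add_cancel]
  rw [mul_comm (g y), ← mul_assoc, mul_assoc _ _ (Real.exp _), ← Real.exp_add]
  congr 3
  push_cast
  ring

variable {Ω : Type*} {mΩ : MeasurableSpace Ω} {P : Measure Ω}

/-- The Cameron-Martin formula for a standard Gaussian variable `Y` and an independent `Z`. -/
lemma integral_mul_exp_of_indepFun [IsProbabilityMeasure P] {E : Type*} [MeasurableSpace E]
    {Z : Ω → E} {Y : Ω → ℝ} (hZ : AEMeasurable Z P) (hY : AEMeasurable Y P)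
    (hind : IndepFun Z Y P) (hlaw : P.map Y = gaussianReal 0 1) {g : E × ℝ → ℝ}
    (hg : Measurable g)
    (hi1 : Integrable (fun ω => g (Z ω, Y ω) * Real.exp (Y ω - 1 / 2)) P)
    (hi2 : Integrable (fun ω => g (Z ω, Y ω + 1)) P) :
    ∫ ω, g (Z ω, Y ω) * Real.exp (Y ω - 1 / 2) ∂P = ∫ ω, g (Z ω, Y ω + 1) ∂P := by
  have hZY := hZ.prodMk hY
  have hmap := (indepFun_iff_map_prod_eq_prod_map_map hZ hY).1 hind
  rw [hlaw] at hmap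
  have : IsProbabilityMeasure (P.map Z) := Measure.isProbabilityMeasure_map hZ
  have hm1 : Measurable fun x : E × ℝ => g x * Real.exp (x.2 - 1 / 2) := by fun_prop
  have hm2 : Measurable fun x : E × ℝ => g (x.1, x.2 + 1) := by fun_prop
  have hi1' := (integrable_map_measure hm1.aestronglyMeasurable hZY).2 hi1
  have hi2' := (integrable_map_measure hm2.aestronglyMeasurable hZY).2 hi2
  have e1 := integral_map hZY hm1.aestronglyMeasurable
  have e2 := integral_map hZY hm2.aestronglyMeasurable
  rw [hmap] at hi1' hi2' e1 e2
  rw [← e1, ← e2, integral_prod _ hi1', integral_prod _ hi2']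
  exact integral_congr_ae (ae_of_all _ fun z => integral_gaussianReal_mul_exp fun y => g (z, y))

/-- All finite exponents are treated together because Hölder's inequality for a product in `L^q`
uses the factors in `L^{2q}`. -/
lemma memLp_eval_mvPolynomial [IsFiniteMeasure P] {ι : Type*} {X : ι → Ω → ℝ}
    (hX : ∀ i (q : ENNReal), q ≠ ⊤ → MemLp (X i) q P) (p : MvPolynomial ι ℝ) :
    ∀ q : ENNReal, q ≠ ⊤ → MemLp (fun ω => MvPolynomial.eval (fun i => X i ω) p) q P := by
  induction p using MvPolynomial.induction_on with
  | C a => simpa using fun q _ => memLp_const a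
  | add p r hp hr =>
    intro q hq
    simp only [map_add]
    exact (hp q hq).add (hr q hq)
  | mul_X p i hp =>
    intro q hq
    have hq2 : 2 * q ≠ ⊤ := ENNReal.mul_ne_top ENNReal.ofNat_ne_top hq
    have : ENNReal.HolderTriple (2 * q) (2 * q) q := ⟨by
      rw [ENNReal.mul_inv (Or.inl two_ne_zero) (Or.inl ENNReal.ofNat_ne_top), ← add_mul,
        ENNReal.inv_two_add_inv_two, one_mul]⟩
    simp only [map_mul, MvPolynomial.eval_X]
    exact (hX i _ hq2).mul (hp _ hq2)

lemma memLp_exp_of_map_eq_gaussianReal [IsProbabilityMeasure P] {Y : Ω → ℝ} (hY : AEMeasurable Y P)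
    (hlaw : P.map Y = gaussianReal 0 1) (c : ℝ) : MemLp (fun ω => Real.exp (Y ω - c)) 2 P := by
  have hm : AEStronglyMeasurable (fun ω => Real.exp (Y ω - c)) P :=
    AEMeasurable.aestronglyMeasurable (by fun_prop)
  rw [memLp_two_iff_integrable_sq hm]
  have h1 : Integrable (fun x => Real.exp (2 * x)) (P.map Y) := by
    rw [hlaw]
    exact integrable_exp_mul_gaussianReal 2
  have h2 := ((integrable_map_measure h1.1 hY).1 h1).const_mul (Real.exp (-(2 * c)))
  refine h2.congr (ae_of_all _ fun ω => ?_)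
  simp only [Function.comp_apply]
  rw [← Real.exp_add, ← Real.exp_nat_mul]
  congr 1
  push_cast
  ring

end Gaussian

/-! ### Transfer to Wiener space -/

lemma memLp_wienerIntegral_of_ne_top (hγ : IsWienerMeasure γ) {h : PathSpace} (hh : h ∈ cmSpace)
    {q : ENNReal} (hq : q ≠ ⊤) : MemLp (wienerIntegral h) q γ :=
  ((isGaussianProcess_wienerIntegral hγ).hasGaussianLaw_eval ⟨h, hh⟩).memLp hq

lemma map_wienerIntegral (hγ : IsWienerMeasure γ) {θ : PathSpace} (hθ : θ ∈ cmSpace)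
    (h1 : cmInner θ θ = 1) : γ.map (wienerIntegral θ) = gaussianReal 0 1 := by
  have := hγ.isProbabilityMeasure
  have h := ((isGaussianProcess_wienerIntegral hγ).hasGaussianLaw_eval
    ⟨θ, hθ⟩).map_eq_gaussianReal
  have hv : Var[wienerIntegral θ; γ] = 1 := by
    rw [variance_eq_sub (memLp_wienerIntegral hγ hθ), integral_wienerIntegral hγ hθ]
    simp [pow_two, integral_wienerIntegral_mul hγ hθ hθ, h1]
  simpa [integral_wienerIntegral hγ hθ, hv] using h

/-- Subtracting the component along the unit vector `θ` leaves covariance `⟨hᵢ, θ⟩ - ⟨hᵢ, θ⟩ |θ|² =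
0` with `[θ]`, and joint Gaussianity upgrades this to independence. -/
lemma indepFun_wienerIntegral (hγ : IsWienerMeasure γ) {θ : PathSpace} (hθ : θ ∈ cmSpace)
    (h1 : cmInner θ θ = 1) {n : ℕ} {h : Fin n → PathSpace} (hh : ∀ i, h i ∈ cmSpace) :
    IndepFun (fun w i => wienerIntegral (h i) w - cmInner (h i) θ * wienerIntegral θ w)
      (wienerIntegral θ) γ := by
  classical
  have := hγ.isProbabilityMeasure
  have hθ2 := memLp_wienerIntegral hγ hθ
  have hh2 (i) := memLp_wienerIntegral hγ (hh i)
  have hZ2 (i) : MemLp (fun w => wienerIntegral (h i) w - cmInner (h i) θ * wienerIntegral θ w)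
      2 γ := (hh2 i).sub (hθ2.const_mul _)
  have hG : IsGaussianProcess (Sum.elim
      (fun (i : Fin n) w => wienerIntegral (h i) w - cmInner (h i) θ * wienerIntegral θ w)
      (fun (_ : Unit) w => wienerIntegral θ w)) γ := by
    have hW := isGaussianProcess_wienerIntegral hγ
    refine hW.of_isGaussianProcess fun s => ?_
    rcases s with i | s
    · refine ⟨{⟨h i, hh i⟩, ⟨θ, hθ⟩}, ContinuousLinearMap.proj (R := ℝ) ⟨⟨h i, hh i⟩, by simp⟩ -
        cmInner (h i) θ • ContinuousLinearMap.proj (R := ℝ) ⟨⟨θ, hθ⟩, by simp⟩, fun w => ?_⟩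
      simp
    · refine ⟨{⟨θ, hθ⟩}, ContinuousLinearMap.proj (R := ℝ) ⟨⟨θ, hθ⟩, by simp⟩, fun w => ?_⟩
      simp
  have key := hG.indepFun_of_covariance_eq_zero (fun i => (hZ2 i).1.aemeasurable)
    (fun _ => hθ2.1.aemeasurable) (fun i _ => ?_)
  · exact key.comp measurable_id (ψ := fun x : Unit → ℝ => x ()) (measurable_pi_apply _)
  · have e : (fun w => wienerIntegral (h i) w - cmInner (h i) θ * wienerIntegral θ w) =
        ⇑(wienerIntegral (h i)) - fun w => cmInner (h i) θ * wienerIntegral θ w := rfl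
    rw [e, covariance_sub_left (hh2 i) (hθ2.const_mul _) hθ2, covariance_const_mul_left,
      covariance_eq_sub (hh2 i) hθ2, covariance_eq_sub hθ2 hθ2]
    simp [integral_wienerIntegral hγ hθ, integral_wienerIntegral_mul hγ hθ hθ,
      integral_wienerIntegral_mul hγ (hh i) hθ, h1]

/-- The Cameron-Martin formula for polynomial functionals. -/
theorem cameronMartin_poly (hγ : IsWienerMeasure γ) {θ : PathSpace} (hθ : θ ∈ cmSpace)
    (h1 : cmInner θ θ = 1) {F : PathSpace → ℝ} (hF : F ∈ polyFunctionals) :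
    Integrable (fun w => F (w + θ)) γ ∧
      Integrable (fun w => F w * Real.exp (wienerIntegral θ w - 1 / 2)) γ ∧
      ∫ w, F (w + θ) ∂γ = ∫ w, F w * Real.exp (wienerIntegral θ w - 1 / 2) ∂γ := by
  have := hγ.isProbabilityMeasure
  obtain ⟨n, h, p, hh, hFp⟩ := hF
  have hY := (memLp_wienerIntegral hγ hθ).1.aemeasurable
  have hlaw := map_wienerIntegral hγ hθ h1
  set c : Fin n → ℝ := fun i => cmInner (h i) θ with hc
  set Z : PathSpace → Fin n → ℝ :=
    fun w i => wienerIntegral (h i) w - c i * wienerIntegral θ w with hZ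
  have hZm : AEMeasurable Z γ := aemeasurable_pi_lambda _ fun i =>
    (memLp_wienerIntegral hγ (hh i)).1.aemeasurable.sub (hY.const_mul _)
  set g : (Fin n → ℝ) × ℝ → ℝ := fun x => MvPolynomial.eval (fun i => x.1 i + c i * x.2) p with hg
  have hgm : Measurable g := by
    have : Continuous g := (MvPolynomial.continuous_eval p).comp (by fun_prop)
    exact this.measurable
  have e1 (w : PathSpace) : F w = g (Z w, wienerIntegral θ w) := by
    simp only [hFp, hg, hZ, sub_add_cancel]
  -- Since `[hᵢ](w + θ) = [hᵢ](w) + cᵢ`, translation by `θ` amounts to adding `1` to the second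
  -- argument of `g`, with `Z` unchanged.
  have e2 (w : PathSpace) : F (w + θ) = g (Z w, wienerIntegral θ w + 1) := by
    simp only [hFp, hg, hZ, map_add, wienerIntegral_apply_of_mem (hh _) hθ, hc]
    congr 2
    ext i
    ring
  have hi1 : Integrable (fun w => F w * Real.exp (wienerIntegral θ w - 1 / 2)) γ := by
    refine MemLp.integrable_mul (p := 2) (q := 2) ?_ (memLp_exp_of_map_eq_gaussianReal hY hlaw _)
    rw [funext hFp]
    exact memLp_eval_mvPolynomial (fun i q hq => memLp_wienerIntegral_of_ne_top hγ (hh i) hq) p _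
      ENNReal.ofNat_ne_top
  have hi2 : Integrable (fun w => F (w + θ)) γ := by
    rw [← memLp_one_iff_integrable]
    simp only [hFp, map_add]
    exact memLp_eval_mvPolynomial
      (fun i q hq => (memLp_wienerIntegral_of_ne_top hγ (hh i) hq).add (memLp_const _)) p _
      ENNReal.one_ne_top
  refine ⟨hi2, hi1, ?_⟩
  simp only [e1] at hi1
  simp only [e2] at hi2
  have hmain := integral_mul_exp_of_indepFun hZm hY (indepFun_wienerIntegral hγ hθ h1 hh) hlaw hgm
    hi1 hi2
  simp only [e2]
  rw [← hmain]
  simp only [e1]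

end CameronMartin

/-! ### Assembly of the three assertions -/

theorem mainTheorem6 (γ : Measure CameronMartin.PathSpace)
    (hγ : CameronMartin.IsWienerMeasure γ) :
    -- `[h]` is the Wiener integral of `ḣ`
    (∀ h ∈ CameronMartin.cmSpace,
      CameronMartin.IsWienerIntegral γ (CameronMartin.pathDeriv h)
        (CameronMartin.wienerIntegral h)) ∧
    ∀ θ ∈ CameronMartin.cmSpace, CameronMartin.cmNorm θ = 1 →
      -- the iterates of `D_θ^*` on `1` are the Hermite functionals, and lie in `𝐏`
      (∀ n : ℕ,
        (CameronMartin.Dstar θ)^[n] 1 =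
            (fun w => CameronMartin.H n (CameronMartin.wienerIntegral θ w)) ∧
          (CameronMartin.Dstar θ)^[n] 1 ∈ CameronMartin.polyFunctionals ∧
          ∀ w, LineDifferentiableAt ℝ ((CameronMartin.Dstar θ)^[n] 1) w θ) ∧
      -- the series defining `e^{D_θ^*} 1` converges, to the exponential functional
      (∀ w, Summable (fun n : ℕ =>
          (1 / (n.factorial : ℝ)) * ((CameronMartin.Dstar θ)^[n] 1) w) ∧
        CameronMartin.expOp (CameronMartin.Dstar θ) 1 w =
          Real.exp (CameronMartin.wienerIntegral θ w - 1 / 2)) ∧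
      -- duality, with well-definedness of both sides
      (∀ F ∈ CameronMartin.polyFunctionals,
        (∀ (n : ℕ) (w : CameronMartin.PathSpace),
          LineDifferentiableAt ℝ ((CameronMartin.D θ)^[n] F) w θ) ∧
        (∃ N : ℕ, ∀ n ≥ N, (CameronMartin.D θ)^[n] F = 0) ∧
        Integrable (CameronMartin.expOp (CameronMartin.D θ) F) γ ∧
        Integrable (fun w => F w * CameronMartin.expOp (CameronMartin.Dstar θ) 1 w) γ ∧
        ∫ w, CameronMartin.expOp (CameronMartin.D θ) F w ∂γ =
          ∫ w, F w * CameronMartin.expOp (CameronMartin.Dstar θ) 1 w ∂γ) := by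
  refine ⟨fun h hh => CameronMartin.isWienerIntegral_wienerIntegral hγ hh, fun θ hθ hθ1 => ?_⟩
  have h1 : CameronMartin.cmInner θ θ = 1 := by
    rwa [CameronMartin.cmNorm, Real.sqrt_eq_one] at hθ1
  have hθθ : CameronMartin.wienerIntegral θ θ = 1 := by
    rw [CameronMartin.wienerIntegral_apply_of_mem hθ hθ, h1]
  have hsum (w : CameronMartin.PathSpace) :
      HasSum (fun n : ℕ => (1 / (n.factorial : ℝ)) * ((CameronMartin.Dstar θ)^[n] 1) w)
        (Real.exp (CameronMartin.wienerIntegral θ w - 1 / 2)) := by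
    simp only [CameronMartin.iterate_Dstar_one hθθ]
    exact CameronMartin.hasSum_hermite _
  have hexp (w : CameronMartin.PathSpace) :
      CameronMartin.expOp (CameronMartin.Dstar θ) 1 w =
        Real.exp (CameronMartin.wienerIntegral θ w - 1 / 2) := (hsum w).tsum_eq
  refine ⟨fun n => ?_, fun w => ⟨(hsum w).summable, hexp w⟩, fun F hF => ?_⟩
  · rw [CameronMartin.iterate_Dstar_one hθθ]
    exact ⟨rfl, CameronMartin.H_mem_polyFunctionals hθ n,
      fun w => (CameronMartin.hasLineDerivAt_H hθθ n w).lineDifferentiableAt⟩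
  -- The bound `N` precedes `w`: the vanishing of `D_θⁿ F` for large `n` must hold as an identity of
  -- functionals.
  · have hline : ∃ N : ℕ, ∀ w, ∃ q : Polynomial ℝ, q.natDegree ≤ N ∧
        ∀ t : ℝ, F (w + t • θ) = q.eval t := by
      obtain ⟨n, h, p, -, hFp⟩ := hF
      exact ⟨p.totalDegree * 1, fun w => ⟨CameronMartin.linePoly h p θ w,
        CameronMartin.natDegree_linePoly_le h p θ w, fun t => by
          rw [CameronMartin.eval_linePoly, hFp]⟩⟩
    obtain ⟨N, hN⟩ := hline
    have hshift : CameronMartin.expOp (CameronMartin.D θ) F = fun w => F (w + θ) := by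
      ext w
      obtain ⟨q, -, hq⟩ := hN w
      exact CameronMartin.expOp_D_eq hq
    have hcm := CameronMartin.cameronMartin_poly hγ hθ h1 hF
    rw [hshift]
    simp only [hexp]
    refine ⟨fun n w => ?_, ⟨N + 1, fun n hn => ?_⟩, hcm⟩
    · obtain ⟨q, -, hq⟩ := hN w
      exact CameronMartin.lineDifferentiableAt_iterate_D hq n
    · ext w
      obtain ⟨q, hqN, hq⟩ := hN w
      have := CameronMartin.iterate_D_eval n hq 0
      rw [zero_smul, add_zero] at this
      rw [this, Polynomial.iterate_derivative_eq_zero (by omega)]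
      simp
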